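/- \textbf{Setting.} Let $E=(E^0,E^1,r,s)$ be a finite directed graph with no sources and no sinks (every vertex is $r(e)$ for some edge $e$, and is $s(e)$ for some edge $e$). Paths are strings $e_1\dots e_n$ of edges with $s(e_i)=r(e_{i+1})$, vertices being the paths of length $0$; $E^n$ is the set of paths of length $n$, $E^*=\bigcup_{n\ge 0}E^n$, and $E^\infty$, $E^{-\infty}$, $E^{\mathbb Z}$ are the right-, left- and bi-infinite paths with the cylinder-set topologies. Let $G$ be a groupoid with unit space $E^0$, with domain and codomain maps $d,c$, acting faithfully on $E^*$: each $g\in G$ acts as a bijection $d(g)E^*\to c(g)E^*$ that preserves length and satisfies $g\cdot(\mu e)\in (g\cdot\mu)E^1$; units act as identities, products as composites, and distinct elements act differently. Suppose $(G,E)$ is self-similar: for $g\in G$ and $e\in d(g)E^1$ there is a (necessarily unique) $g|_e\in G$ with $g\cdot(e\mu)=(g\cdot e)(g|_e\cdot\mu)$ for all $\mu\in s(e)E^*$; for paths let $g|_\mu$ be the unique element with $g\cdot(\mu\nu)=(g\cdot\mu)(g|_\mu\cdot\nu)$ for all $\nu \in s(\mu)E^*$. Suppose $(G,E)$ is \emph{contracting}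 (there is a finite $F\subseteq G$ such that for every $g\in G$ there is $n\ge 0$ with $\{g|_\mu:\mu\in d(g)E^n\}\subseteq F$) and \emph{regular} (if $g\cdot y=y$ with $y\in E^\infty$, then some initial segment $\mu$ of $y$ satisfies $g\cdot\mu=\mu$ and $g|_\mu=s(\mu)$). For $x,y\in E^{-\infty}$ write $x\sim_{ae}y$ if there are $g_n\in G$ $(n<0)$, taking finitely many values, with $g_n\cdot x_n\dots x_{-1}=y_n\dots y_{-1}$ for all $n<0$; for $x,y\in E^{\mathbb Z}$ write $x\sim_{ae}y$ if there are $g_n\in G$ $(n\in\mathbb Z)$, taking finitely many values, with $g_n\cdot x_nx_{n+1}\dots=y_ny_{n+1}\dots$ for all $n$. Let $\mathcal J=E^{-\infty}/{\sim_{ae}}$ be the limit space and $\mathcal S=E^{\mathbb Z}/{\sim_{ae}}$ the limit solenoid, with the quotient topologies; let $\tilde\sigma:\mathcal J\to\mathcal J$ be induced by $\sigma(\dots x_{-2}x_{-1})=\dots x_{-3}x_{-2}$, let $\tau(x)_n=x_{n-1}$ on $E^{\mathbb Z}$, and put $x(-\infty,m)=\dots x_{m-1}x_m\in E^{-\infty}$.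 Call $(d_{\mathcal J},\varepsilon,c)$ an \emph{expanding metric} if $\varepsilon>0$, $c>1$ and $d_{\mathcal J}$ is a metric inducing the topology of $\mathcal J$ such that $d_{\mathcal J}(\tilde\sigma z,\tilde\sigma z')=c\,d_{\mathcal J}(z,z')$ whenever $d_{\mathcal J}(z,z')<\varepsilon$, and $\tilde\sigma(B(z,\alpha))=B(\tilde\sigma z,c\alpha)$ for all $z \in \mathcal J$ and $\alpha\le\varepsilon$ (open balls). A \emph{Smale space} $(X,d,\varphi,\varepsilon_X,\lambda)$ is a compact metric space $(X,d)$ with a homeomorphism $\varphi$, constants $\varepsilon_X>0$, $0<\lambda<1$, and a continuous bracket $[\cdot,\cdot]:\{d(x,y)\le\varepsilon_X\}\to X$ such that $[x,x]=x$; $[x,[y,z]]=[x,z]$, $[[x,y],z]=[x,z]$ and $\varphi[x,y]=[\varphi x,\varphi y]$ whenever both sides are defined; $d(\varphi x,\varphi y)\le\lambda d(x,y)$ if $[x,y]=y$; and $d(\varphi^{-1}x,\varphi^{-1}y)\le\lambda d(x,y)$ if $[x,y]=x$. Its local stable sets are $X^s(x,\delta)=\{y:d(x,y)<\delta,\ [y,x]=x\}$,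 $0<\delta\le\varepsilon_X$; its global stable sets are $X^s(x)=\{y:d(\varphi^nx,\varphi^ny)\to0 \text{ as } n\to\infty\}$ with the topology generated by the sets $X^s(y,\delta)$, $y\in X^s(x)$, $0<\delta<\varepsilon_X$. \textbf{Statement.} \begin{enumerate} \item There is a homeomorphism $\tilde\tau:\mathcal S\to\mathcal S$ with $\tilde\tau([x])=[\tau(x)]$ for all $x\in E^{\mathbb Z}$. \item Expanding metrics $(d_{\mathcal J},\varepsilon,c)$ on $\mathcal J$ exist. For every such triple there is a metric $d_{\mathcal S}$ on $\mathcal S$, inducing its topology, with \[ d_{\mathcal S}([x],[y])=\sup_{m\ge0}\,(1/c)^m\, d_{\mathcal J}\big([x(-\infty,m)],[y(-\infty,m)]\big)\qquad(x,y\in E^{\mathbb Z}), \] and there is a constant $\varepsilon_{\mathcal S}>0$ such that $(\mathcal S,d_{\mathcal S},\tilde\tau,\varepsilon_{\mathcal S},1/c)$ is a Smale space (for some bracket) whose stable sets, local (as subspaces) and global, are totally disconnected. \item If $E$ is strongly connected ($E$ has an edge and $vE^*w\neq\varnothing$ for all $v,w\in E^0$), then $(\mathcal S,\tilde\tau)$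 is irreducible: for all non-empty open $U,W\subseteq\mathcal S$ there is $N\ge0$ with $\tilde\tau^N(U)\cap W\ne\varnothing$. \item If $E$ is primitive (for some $n\ge1$, $vE^nw\neq\varnothing$ for all $v,w\in E^0$), then $(\mathcal S,\tilde\tau)$ is topologically mixing: for all non-empty open $U,W\subseteq\mathcal S$ there is $N$ with $\tilde\tau^n(U)\cap W\ne\varnothing$ for all $n\ge N$. \end{enumerate} -/

import Mathlib

open CategoryTheory Filter Topology

universe u v w

/-- A directed graph with vertex set `V` and edge set `Edge`; the edge `e` points from `s e` to
`r e`. -/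
structure DirectedGraph (V : Type u) (Edge : Type v) where
  r : Edge → V
  s : Edge → V

namespace DirectedGraph

variable {V : Type u} {Edge : Type v} (E : DirectedGraph V Edge)

/-- `E.IsPath v [e₁, …, eₙ]`: the string `e₁ … eₙ` is a path (`s eᵢ = r eᵢ₊₁`) with range `v`.
The empty string, read with range `v`, is the vertex `v` regarded as a path of length `0`. -/
def IsPath : V → List Edge → Prop
  | _, [] => True
  | v, e :: μ => E.r e = v ∧ IsPath (E.s e) μ

/-- The source of a path with range `v`. -/
def source : V → List Edge → V
  | v, [] => v
  | _, e :: μ => source (E.s e) μ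

theorem isPath_append {E : DirectedGraph V Edge} {v : V} {μ ν : List Edge} (hμ : E.IsPath v μ)
    (hν : E.IsPath (E.source v μ) ν) : E.IsPath v (μ ++ ν) := by
  induction μ generalizing v with
  | nil => simpa [source] using hν
  | cons e μ ih => exact ⟨hμ.1, ih hμ.2 hν⟩

/-- The set `v E^*` of finite paths with range `v`. -/
abbrev PathsTo (v : V) : Type v := {μ : List Edge // E.IsPath v μ}

/-- Every vertex receives an edge: `v E^1 ≠ ∅` for all `v`. -/
def NoSources : Prop := ∀ v : V, ∃ e : Edge, E.r e = v

/-- Every vertex emits an edge: `E^1 v ≠ ∅` for all `v`. -/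
def NoSinks : Prop := ∀ v : V, ∃ e : Edge, E.s e = v

/-- `E` has an edge, and `v E^* w ≠ ∅` for all vertices `v`, `w`. -/
def StronglyConnected : Prop :=
  Nonempty Edge ∧ ∀ v w : V, ∃ μ : List Edge, E.IsPath v μ ∧ E.source v μ = w

/-- There is `n ≥ 1` such that `v E^n w ≠ ∅` for all vertices `v`, `w`. -/
def Primitive : Prop :=
  ∃ n : ℕ, 1 ≤ n ∧ ∀ v w : V, ∃ μ : List Edge, μ.length = n ∧ E.IsPath v μ ∧ E.source v μ = w

/-- Right-infinite paths `y₁ y₂ y₃ …`; the edge `y_{k+1}` is stored at `k`. -/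
structure RightPath where
  edge : ℕ → Edge
  chain : ∀ k, E.s (edge k) = E.r (edge (k + 1))

/-- Left-infinite paths `… x₋₃ x₋₂ x₋₁`; the edge `x_{-(k+1)}` is stored at `k`. -/
structure LeftPath where
  edge : ℕ → Edge
  chain : ∀ k, E.s (edge (k + 1)) = E.r (edge k)

/-- Bi-infinite paths `… x₋₁ x₀ x₁ …`. -/
structure BiPath where
  edge : ℤ → Edge
  chain : ∀ n, E.s (edge n) = E.r (edge (n + 1))

/-- The topology of left-infinite paths: cylinder sets, that is, the restriction of the product
of the discrete topologies. -/
instance : TopologicalSpace E.LeftPath :=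
  TopologicalSpace.induced (fun x : E.LeftPath => x.edge)
    (@Pi.topologicalSpace ℕ (fun _ => Edge) (fun _ => ⊥))

/-- The topology of bi-infinite paths: cylinder sets, that is, the restriction of the product
of the discrete topologies. -/
instance : TopologicalSpace E.BiPath :=
  TopologicalSpace.induced (fun x : E.BiPath => x.edge)
    (@Pi.topologicalSpace ℤ (fun _ => Edge) (fun _ => ⊥))

variable {E}

/-- The initial segment `y₁ … yₙ`. -/
def RightPath.initial (y : E.RightPath) (n : ℕ) : List Edge := (List.range n).map y.edge

/-- The range `r(y₁)`. -/
def RightPath.range (y : E.RightPath) : V := E.r (y.edge 0)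

/-- The final segment `x₋ₙ … x₋₁`. -/
def LeftPath.final (x : E.LeftPath) (n : ℕ) : List Edge := (List.range n).reverse.map x.edge

/-- The shift `σ(… x₋₃ x₋₂ x₋₁) = … x₋₃ x₋₂`. -/
def LeftPath.shift (x : E.LeftPath) : E.LeftPath :=
  ⟨fun k => x.edge (k + 1), fun k => x.chain (k + 1)⟩

/-- The segment `xₙ xₙ₊₁ … xₙ₊ₖ₋₁`. -/
def BiPath.segment (x : E.BiPath) (n : ℤ) (k : ℕ) : List Edge :=
  (List.range k).map fun i : ℕ => x.edge (n + i)

/-- The translation `τ(x)ₙ = xₙ₋₁`. -/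
def BiPath.translate (x : E.BiPath) : E.BiPath :=
  ⟨fun n => x.edge (n - 1), fun n => by
    rw [x.chain (n - 1)]; congr 2; omega⟩

/-- The left-infinite path `x(-∞, n) = … xₙ₋₂ xₙ₋₁ xₙ`. -/
def BiPath.leftPart (x : E.BiPath) (n : ℤ) : E.LeftPath :=
  ⟨fun k => x.edge (n - k), fun k => by
    rw [x.chain (n - ((k + 1 : ℕ) : ℤ))]; congr 2; omega⟩

theorem RightPath.isPath_initial (y : E.RightPath) (n : ℕ) : E.IsPath y.range (y.initial n) := by
  have key : ∀ (n j : ℕ), E.IsPath (E.r (y.edge j)) ((List.range n).map fun i => y.edge (j + i)) := by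
    intro n
    induction n with
    | zero => intro j; simp [IsPath]
    | succ n ih =>
      intro j
      rw [List.range_succ_eq_map]
      simp only [List.map_cons, List.map_map, IsPath]
      refine ⟨by simp, ?_⟩
      have h := ih (j + 1)
      rw [← y.chain j] at h
      have e : ((fun i => y.edge (j + i)) ∘ Nat.succ) = fun i => y.edge (j + 1 + i) := by
        funext i
        simp only [Function.comp_apply]
        congr 1
        omega
      rw [e]
      exact h
  simpa [RightPath.range, RightPath.initial] using key n 0

theorem LeftPath.isPath_final (x : E.LeftPath) (n : ℕ) :
    E.IsPath (E.r (x.edge n)) (x.final (n + 1)) := by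
  induction n with
  | zero => simp [LeftPath.final, IsPath]
  | succ n ih =>
    have : x.final (n + 1 + 1) = x.edge (n + 1) :: x.final (n + 1) := by
      simp [LeftPath.final, List.range_succ]
    rw [this]
    exact ⟨rfl, by rw [x.chain n]; exact ih⟩

theorem LeftPath.final_shift (x : E.LeftPath) (n : ℕ) :
    x.final (n + 1) = x.shift.final n ++ [x.edge 0] := by
  simp [LeftPath.final, LeftPath.shift, List.range_succ_eq_map, List.map_reverse, Function.comp_def]

theorem BiPath.isPath_segment (x : E.BiPath) (n : ℤ) (k : ℕ) :
    E.IsPath (E.r (x.edge n)) (x.segment n k) := by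
  induction k generalizing n with
  | zero => simp [BiPath.segment, IsPath]
  | succ k ih =>
    have h := ih (n + 1)
    rw [← x.chain n] at h
    unfold BiPath.segment at h ⊢
    rw [List.range_succ_eq_map]
    rw [List.map_cons, List.map_map]
    refine ⟨by simp, ?_⟩
    have e : ((fun i : ℕ => x.edge (n + i)) ∘ Nat.succ) = fun i : ℕ => x.edge (n + 1 + i) := by
      funext i
      show x.edge (n + ((i + 1 : ℕ) : ℤ)) = _
      congr 1
      omega
    have e0 : n + ((0 : ℕ) : ℤ) = n := by simp
    rw [e, e0]
    exact h

variable (E)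

/-- Partial isomorphisms `v E^* → w E^*`: length-preserving bijections `g` with
`g (μ e) ∈ g (μ) E^1`. -/
structure PartialIso (v w : V) extends E.PathsTo v ≃ E.PathsTo w where
  length_map : ∀ μ : E.PathsTo v, (toFun μ).1.length = μ.1.length
  map_concat : ∀ (μ μe : E.PathsTo v) (e : Edge), μe.1 = μ.1 ++ [e] →
    ∃ f : Edge, (toFun μe).1 = (toFun μ).1 ++ [f]

end DirectedGraph

open DirectedGraph

/-- A self-similar groupoid action `(G, E)`. The groupoid `G` has unit space `V`: its elements with
domain `v` and codomain `w` are the morphisms `v ⟶ w`, and the product `h g` is `g ≫ h`.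
It acts faithfully by partial isomorphisms, and for every `g` and every edge `e` with
`r e = d(g)` there is `h ∈ G` with `g · (e μ) = (g · e) (h · μ)` for all `μ ∈ s(e) E^*`. -/
structure SelfSimilarAction {V : Type u} {Edge : Type v} (E : DirectedGraph V Edge)
    [Groupoid.{w} V] where
  toPartialIso : ∀ {v w : V}, (v ⟶ w) → E.PartialIso v w
  map_id : ∀ (v : V) (μ : E.PathsTo v), (toPartialIso (𝟙 v)).toEquiv μ = μ
  map_comp : ∀ {u v w : V} (g : u ⟶ v) (h : v ⟶ w) (μ : E.PathsTo u),
    (toPartialIso (g ≫ h)).toEquiv μ = (toPartialIso h).toEquiv ((toPartialIso g).toEquiv μ)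
  faithful : ∀ v w : V, Function.Injective (fun g : v ⟶ w => toPartialIso g)
  self_similar : ∀ {v w : V} (g : v ⟶ w) (e : Edge) (he : E.r e = v),
    ∃ (f : Edge) (h : E.s e ⟶ E.s f), ∀ μ : E.PathsTo (E.s e),
      ((toPartialIso g).toEquiv ⟨e :: μ.1, he, μ.2⟩).1 = f :: ((toPartialIso h).toEquiv μ).1

/-- The set of all elements of a groupoid with unit space `V`: triples (domain, codomain,
morphism). -/
abbrev GroupoidElt (V : Type u) [Groupoid.{w} V] := Σ v w : V, (v ⟶ w)

namespace SelfSimilarAction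

variable {V : Type u} {Edge : Type v} {E : DirectedGraph V Edge} [Groupoid.{w} V]
  (A : SelfSimilarAction E)

/-- The path `g · μ`. -/
def act {v w : V} (g : v ⟶ w) (μ : E.PathsTo v) : E.PathsTo w := (A.toPartialIso g).toEquiv μ

theorem exists_restriction {v w : V} (g : v ⟶ w) (μ : E.PathsTo v) :
    ∃ h : E.source v μ.1 ⟶ E.source w (A.act g μ).1, ∀ ν : E.PathsTo (E.source v μ.1),
      (A.act g ⟨μ.1 ++ ν.1, isPath_append μ.2 ν.2⟩).1 = (A.act g μ).1 ++ (A.act h ν).1 := by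
  obtain ⟨μ, hμ⟩ := μ
  suffices H : ∃ (u : V) (h : E.source v μ ⟶ u), u = E.source w (A.act g ⟨μ, hμ⟩).1 ∧
      ∀ ν : E.PathsTo (E.source v μ),
        (A.act g ⟨μ ++ ν.1, isPath_append hμ ν.2⟩).1 = (A.act g ⟨μ, hμ⟩).1 ++ (A.act h ν).1 by
    obtain ⟨u, h, rfl, hh⟩ := H
    exact ⟨h, hh⟩
  induction μ generalizing v w with
  | nil =>
    have h0 : (A.act g ⟨[], hμ⟩).1 = [] := by
      have := (A.toPartialIso g).length_map ⟨[], hμ⟩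
      exact List.length_eq_zero_iff.1 this
    refine ⟨w, g, by rw [h0]; rfl, fun ν => ?_⟩
    rw [h0]; rfl
  | cons e μ ih =>
    obtain ⟨f, k, hk⟩ := A.self_similar g e hμ.1
    obtain ⟨u, h, hu, hh⟩ := ih k hμ.2
    have h1 : (A.act g ⟨e :: μ, hμ⟩).1 = f :: (A.act k ⟨μ, hμ.2⟩).1 := hk ⟨μ, hμ.2⟩
    refine ⟨u, h, ?_, fun ν => ?_⟩
    · rw [h1]; exact hu
    · rw [h1]
      refine Eq.trans ?_ (congrArg (fun l => f :: l) (hh ν))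
      exact hk ⟨μ ++ ν.1, isPath_append hμ.2 ν.2⟩

/-- The restriction `g|_μ`: the element `h` of `G` (unique by faithfulness), with domain `s(μ)` and
codomain `s(g · μ)`, such that `g · (μ ν) = (g · μ) (h · ν)` for all `ν ∈ s(μ) E^*`. -/
noncomputable def restrict {v w : V} (g : v ⟶ w) (μ : E.PathsTo v) :
    E.source v μ.1 ⟶ E.source w (A.act g μ).1 :=
  (A.exists_restriction g μ).choose

theorem restrict_spec {v w : V} (g : v ⟶ w) (μ : E.PathsTo v) (ν : E.PathsTo (E.source v μ.1)) :
    (A.act g ⟨μ.1 ++ ν.1, isPath_append μ.2 ν.2⟩).1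
      = (A.act g μ).1 ++ (A.act (A.restrict g μ) ν).1 :=
  (A.exists_restriction g μ).choose_spec ν

/-- The restriction `g|_μ` as an element of the set `G`. -/
noncomputable def restrictElt {v w : V} (g : v ⟶ w) (μ : E.PathsTo v) : GroupoidElt V :=
  ⟨_, _, A.restrict g μ⟩

/-- `(G, E)` is contracting: there is a finite `F ⊆ G` such that for every `g ∈ G` there is `n ≥ 0`
with `{g|_μ : μ ∈ d(g) E^n} ⊆ F`. -/
def IsContracting : Prop :=
  ∃ F : Set (GroupoidElt V), F.Finite ∧ ∀ (v w : V) (g : v ⟶ w), ∃ n : ℕ,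
    ∀ μ : E.PathsTo v, μ.1.length = n → A.restrictElt g μ ∈ F

/-- `(G, E)` is regular: if `g · y = y` for a right-infinite path `y`, then `g · μ = μ` and
`g|_μ = s(μ)` for some initial segment `μ` of `y`. As `g · y = y` forces `c(g) = r(y) = d(g)`,
only `g` with this domain and codomain need be considered; `g · y = y` means that `g` fixes all
initial segments of `y`. -/
def IsRegular : Prop :=
  ∀ (y : E.RightPath) (g : y.range ⟶ y.range),
    (∀ n : ℕ, A.act g ⟨y.initial n, y.isPath_initial n⟩ = ⟨y.initial n, y.isPath_initial n⟩) →
    ∃ n : ℕ,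
      A.act g ⟨y.initial n, y.isPath_initial n⟩ = ⟨y.initial n, y.isPath_initial n⟩ ∧
      A.restrictElt g ⟨y.initial n, y.isPath_initial n⟩ =
        ⟨E.source y.range (y.initial n), E.source y.range (y.initial n), 𝟙 _⟩

/-- `g · μ` is defined and equal to `ν`. -/
def MapsTo (g : GroupoidElt V) (μ ν : List Edge) : Prop :=
  ∃ h : E.IsPath g.1 μ, (A.act g.2.2 ⟨μ, h⟩).1 = ν

variable {A}

theorem mapsTo_id {v : V} {μ : List Edge} (h : E.IsPath v μ) : A.MapsTo ⟨v, v, 𝟙 v⟩ μ μ :=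
  ⟨h, by simp [act, A.map_id]⟩

theorem MapsTo.length_eq {g : GroupoidElt V} {μ ν : List Edge} (h : A.MapsTo g μ ν) :
    ν.length = μ.length := by
  obtain ⟨h, rfl⟩ := h
  exact (A.toPartialIso g.2.2).length_map _

theorem MapsTo.inv {g : GroupoidElt V} {μ ν : List Edge} (h : A.MapsTo g μ ν) :
    A.MapsTo ⟨g.2.1, g.1, Groupoid.inv g.2.2⟩ ν μ := by
  obtain ⟨h, rfl⟩ := h
  refine ⟨(A.act g.2.2 ⟨μ, h⟩).2, ?_⟩
  have := A.map_comp g.2.2 (Groupoid.inv g.2.2) ⟨μ, h⟩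
  rw [Groupoid.comp_inv, A.map_id] at this
  exact congrArg Subtype.val this.symm

/-- The product `h g` of composable elements (and `g` if the two are not composable). -/
noncomputable def eltMul (h g : GroupoidElt V) : GroupoidElt V := by
  classical
  exact if e : g.2.1 = h.1 then ⟨g.1, h.2.1, g.2.2 ≫ eqToHom e ≫ h.2.2⟩ else g

theorem MapsTo.mul {g h : GroupoidElt V} {μ ν κ : List Edge} (hμ : μ ≠ [])
    (hg : A.MapsTo g μ ν) (hh : A.MapsTo h ν κ) : A.MapsTo (eltMul h g) μ κ := by
  have hl := hg.length_eq
  obtain ⟨p, rfl⟩ := hg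
  obtain ⟨q, rfl⟩ := hh
  obtain ⟨a, b, g⟩ := g
  obtain ⟨c, d, h⟩ := h
  have e : b = c := by
    generalize hη : A.act g ⟨μ, p⟩ = η at q hl
    obtain ⟨η, hη'⟩ := η
    cases η with
    | nil => exact absurd (List.length_eq_zero_iff.1 hl.symm) hμ
    | cons x l => exact hη'.1.symm.trans q.1
  subst e
  have e : eltMul ⟨b, d, h⟩ ⟨a, b, g⟩ = ⟨a, d, g ≫ h⟩ := by simp [eltMul]
  rw [e]
  exact ⟨p, congrArg Subtype.val (A.map_comp g h ⟨μ, p⟩)⟩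

theorem MapsTo.of_concat {g : GroupoidElt V} {μ ν : List Edge} {e f : Edge}
    (h : A.MapsTo g (μ ++ [e]) (ν ++ [f])) : A.MapsTo g μ ν := by
  obtain ⟨p, hp⟩ := h
  have q : ∀ (v : V) (μ : List Edge), E.IsPath v (μ ++ [e]) → E.IsPath v μ := by
    intro v μ
    induction μ generalizing v with
    | nil => intro _; trivial
    | cons x μ ih => intro h; exact ⟨h.1, ih _ h.2⟩
  refine ⟨q _ _ p, ?_⟩
  obtain ⟨f', hf⟩ := (A.toPartialIso g.2.2).map_concat ⟨μ, q _ _ p⟩ ⟨μ ++ [e], p⟩ e rfl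
  have := hp.symm.trans hf
  exact (List.append_inj' this rfl).1.symm

variable (A)

/-- Asymptotic equivalence of left-infinite paths: there is a sequence `(gₙ)_{n<0}` in `G` with
finitely many values and `gₙ · xₙ … x₋₁ = yₙ … y₋₁` for all `n < 0`; here `g₋₍ₙ₊₁₎` is stored at
`n`. -/
def LeftAsymp (x y : E.LeftPath) : Prop :=
  ∃ g : ℕ → GroupoidElt V, (Set.range g).Finite ∧
    ∀ n : ℕ, A.MapsTo (g n) (x.final (n + 1)) (y.final (n + 1))

/-- Asymptotic equivalence of bi-infinite paths: there is a sequence `(gₙ)_{n∈ℤ}` in `G` with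
finitely many values and `gₙ · xₙ xₙ₊₁ … = yₙ yₙ₊₁ …` for all `n`, that is, `gₙ` sends
every initial segment of the first path to that of the second. -/
def BiAsymp (x y : E.BiPath) : Prop :=
  ∃ g : ℤ → GroupoidElt V, (Set.range g).Finite ∧
    ∀ (n : ℤ) (k : ℕ), A.MapsTo (g n) (x.segment n k) (y.segment n k)

theorem finite_units [Finite V] {ι : Type*} (f : ι → V) :
    (Set.range fun n => (⟨f n, f n, 𝟙 (f n)⟩ : GroupoidElt V)).Finite :=
  (Set.finite_range fun v : V => (⟨v, v, 𝟙 v⟩ : GroupoidElt V)).subset (by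
    rintro _ ⟨n, rfl⟩; exact ⟨f n, rfl⟩)

theorem finite_inv {ι : Type*} {g : ι → GroupoidElt V} (hg : (Set.range g).Finite) :
    (Set.range fun n => (⟨(g n).2.1, (g n).1, Groupoid.inv (g n).2.2⟩ : GroupoidElt V)).Finite :=
  (hg.image fun k => (⟨k.2.1, k.1, Groupoid.inv k.2.2⟩ : GroupoidElt V)).subset (by
    rintro _ ⟨n, rfl⟩; exact ⟨g n, ⟨n, rfl⟩, rfl⟩)

theorem finite_mul {ι : Type*} {g h : ι → GroupoidElt V} (hg : (Set.range g).Finite)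
    (hh : (Set.range h).Finite) : (Set.range fun n => eltMul (h n) (g n)).Finite :=
  (hh.image2 eltMul hg).subset (by
    rintro _ ⟨n, rfl⟩; exact ⟨h n, ⟨n, rfl⟩, g n, ⟨n, rfl⟩, rfl⟩)

/-- Asymptotic equivalence on `E^{-∞}`. -/
def leftSetoid [Finite V] : Setoid E.LeftPath where
  r := A.LeftAsymp
  iseqv :=
    { refl := fun x => ⟨fun n => ⟨E.r (x.edge n), E.r (x.edge n), 𝟙 _⟩, finite_units _,
        fun n => mapsTo_id (x.isPath_final n)⟩
      symm := fun ⟨g, hg, h⟩ => ⟨_, finite_inv hg, fun n => (h n).inv⟩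
      trans := fun ⟨g, hg, h⟩ ⟨g', hg', h'⟩ => ⟨_, finite_mul hg hg', fun n =>
        MapsTo.mul (by simp [LeftPath.final, List.range_succ]) (h n) (h' n)⟩ }

/-- Asymptotic equivalence on `E^ℤ`. -/
def biSetoid [Finite V] : Setoid E.BiPath where
  r := A.BiAsymp
  iseqv :=
    { refl := fun x => ⟨fun n => ⟨E.r (x.edge n), E.r (x.edge n), 𝟙 _⟩, finite_units _,
        fun n k => mapsTo_id (x.isPath_segment n k)⟩
      symm := fun ⟨g, hg, h⟩ => ⟨_, finite_inv hg, fun n k => (h n k).inv⟩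
      trans := fun {x y z} ⟨g, hg, h⟩ ⟨g', hg', h'⟩ => ⟨_, finite_mul hg hg', fun n k => by
        have key := fun k => MapsTo.mul (A := A) (μ := x.segment n (k + 1))
          (by simp [BiPath.segment, List.range_succ]) (h n (k + 1)) (h' n (k + 1))
        refine MapsTo.of_concat (e := x.edge (n + k)) (f := z.edge (n + k)) ?_
        simpa [BiPath.segment, List.range_succ] using key k⟩ }

/-- The limit space `𝒥 = E^{-∞}/∼`, with the quotient topology. -/
def LimitSpace [Finite V] : Type v := Quotient A.leftSetoid

instance [Finite V] : TopologicalSpace A.LimitSpace :=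
  inferInstanceAs (TopologicalSpace (Quotient A.leftSetoid))

/-- The class `[x] ∈ 𝒥` of a left-infinite path. -/
def toLimitSpace [Finite V] (x : E.LeftPath) : A.LimitSpace := Quotient.mk A.leftSetoid x

/-- The limit solenoid `𝒮 = E^ℤ/∼`, with the quotient topology. -/
def Solenoid [Finite V] : Type v := Quotient A.biSetoid

instance [Finite V] : TopologicalSpace A.Solenoid :=
  inferInstanceAs (TopologicalSpace (Quotient A.biSetoid))

/-- The class `[x] ∈ 𝒮` of a bi-infinite path. -/
def toSolenoid [Finite V] (x : E.BiPath) : A.Solenoid := Quotient.mk A.biSetoid x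

theorem LeftAsymp.shift {x y : E.LeftPath} (h : A.LeftAsymp x y) :
    A.LeftAsymp x.shift y.shift := by
  obtain ⟨g, hg, h⟩ := h
  refine ⟨fun n => g (n + 1), hg.subset (by rintro _ ⟨n, rfl⟩; exact ⟨n + 1, rfl⟩), fun n => ?_⟩
  have := h (n + 1)
  rw [LeftPath.final_shift, LeftPath.final_shift y] at this
  exact this.of_concat

/-- The map `σ̃ : 𝒥 → 𝒥`, `[x] ↦ [σ(x)]`. -/
def shiftLimit [Finite V] : A.LimitSpace → A.LimitSpace :=
  Quotient.map' (s₁ := A.leftSetoid) (s₂ := A.leftSetoid) LeftPath.shift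
    fun _ _ h => LeftAsymp.shift A h

end SelfSimilarAction

/-- `d` is a metric on `X` which induces the given topology of `X`. -/
structure IsCompatibleMetric {X : Type*} [TopologicalSpace X] (d : X → X → ℝ) : Prop where
  self : ∀ x, d x x = 0
  eq_of_zero : ∀ x y, d x y = 0 → x = y
  comm : ∀ x y, d x y = d y x
  triangle : ∀ x y z, d x z ≤ d x y + d y z
  isOpen_iff : ∀ s : Set X, IsOpen s ↔ ∀ x ∈ s, ∃ δ > 0, ∀ y, d x y < δ → y ∈ s

/-- `d`, `ε`, `c` are a metric on `𝒥` (inducing its topology), a radius `ε > 0` and a factor `c > 1`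
such that `σ̃` multiplies distances smaller than `ε` by `c`, and maps the open ball `B(z, α)` onto
`B(σ̃(z), c α)` for all `α ≤ ε`. -/
structure SelfSimilarAction.IsExpandingMetric {V : Type u} {Edge : Type v}
    {E : DirectedGraph V Edge} [Groupoid.{w} V] [Finite V] (A : SelfSimilarAction E)
    (d : A.LimitSpace → A.LimitSpace → ℝ) (ε c : ℝ) : Prop where
  compatible : IsCompatibleMetric d
  ε_pos : 0 < ε
  one_lt : 1 < c
  expand : ∀ z z' : A.LimitSpace, d z z' < ε → d (A.shiftLimit z) (A.shiftLimit z') = c * d z z'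
  image_ball : ∀ (z : A.LimitSpace) (α : ℝ), α ≤ ε →
    A.shiftLimit '' {z' | d z z' < α} = {z' | d (A.shiftLimit z) z' < c * α}

/-- `(X, d, φ, ε, lam)` is a Smale space with bracket `[x, y] = br x y`. Only the values of `br` on
the pairs with `d x y ≤ ε`, where the bracket is defined, are used. -/
structure IsSmaleSpace {X : Type*} [TopologicalSpace X] (d : X → X → ℝ) (φ : X ≃ₜ X)
    (ε lam : ℝ) (br : X → X → X) : Prop where
  compact : CompactSpace X
  metric : IsCompatibleMetric d
  ε_pos : 0 < ε
  lam_pos : 0 < lam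
  lam_lt_one : lam < 1
  continuousOn : ContinuousOn (fun p : X × X => br p.1 p.2) {p | d p.1 p.2 ≤ ε}
  b1 : ∀ x, br x x = x
  b2 : ∀ x y z, d y z ≤ ε → d x (br y z) ≤ ε → d x z ≤ ε → br x (br y z) = br x z
  b3 : ∀ x y z, d x y ≤ ε → d (br x y) z ≤ ε → d x z ≤ ε → br (br x y) z = br x z
  b4 : ∀ x y, d x y ≤ ε → d (φ x) (φ y) ≤ ε → φ (br x y) = br (φ x) (φ y)
  c1 : ∀ x y, d x y ≤ ε → br x y = y → d (φ x) (φ y) ≤ lam * d x y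
  c2 : ∀ x y, d x y ≤ ε → br x y = x → d (φ.symm x) (φ.symm y) ≤ lam * d x y

/-- The local stable set `X^s(x, δ)`. -/
def localStableSet {X : Type*} (d : X → X → ℝ) (br : X → X → X) (x : X) (δ : ℝ) : Set X :=
  {y | d x y < δ ∧ br y x = x}

/-- The global stable class `X^s(x)`. -/
def stableClass {X : Type*} [TopologicalSpace X] (d : X → X → ℝ) (φ : X ≃ₜ X) (x : X) : Set X :=
  {y | Tendsto (fun n : ℕ => d (φ^[n] x) (φ^[n] y)) atTop (𝓝 0)}

/-- The topology of `X^s(x)` generated by the local stable sets `X^s(y, δ)`, where `y ∈ X^s(x)` and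
`0 < δ < ε`. -/
abbrev stableTopology {X : Type*} [TopologicalSpace X] (d : X → X → ℝ) (φ : X ≃ₜ X)
    (ε : ℝ) (br : X → X → X) (x : X) : TopologicalSpace (stableClass d φ x) :=
  TopologicalSpace.generateFrom
    {U | ∃ y ∈ stableClass d φ x, ∃ δ : ℝ, 0 < δ ∧ δ < ε ∧
      U = Subtype.val ⁻¹' localStableSet d br y δ}

/-- The stable sets are totally disconnected: the local ones as subspaces of `X`, and the global
ones in their own topology. -/
def HasTotallyDisconnectedStableSets {X : Type*} [TopologicalSpace X] (d : X → X → ℝ)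
    (φ : X ≃ₜ X) (ε : ℝ) (br : X → X → X) : Prop :=
  (∀ (x : X) (δ : ℝ), 0 < δ → δ ≤ ε → IsTotallyDisconnected (localStableSet d br x δ)) ∧
  ∀ x : X, @TotallyDisconnectedSpace (stableClass d φ x) (stableTopology d φ ε br x)

/-- For all non-empty open `U`, `W` there is `N` with `φ^N(U) ∩ W ≠ ∅`. -/
def IsIrreducibleHomeo {X : Type*} [TopologicalSpace X] (φ : X ≃ₜ X) : Prop :=
  ∀ U W : Set X, IsOpen U → IsOpen W → U.Nonempty → W.Nonempty →
    ∃ N : ℕ, (φ^[N] '' U ∩ W).Nonempty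

/-- For all non-empty open `U`, `W` there is `N` with `φ^n(U) ∩ W ≠ ∅` for all `n ≥ N`. -/
def IsMixingHomeo {X : Type*} [TopologicalSpace X] (φ : X ≃ₜ X) : Prop :=
  ∀ U W : Set X, IsOpen U → IsOpen W → U.Nonempty → W.Nonempty →
    ∃ N : ℕ, ∀ n : ℕ, N ≤ n → (φ^[n] '' U ∩ W).Nonempty

/-! ### Concatenation of finite paths -/

namespace DirectedGraph

variable {V : Type u} {Edge : Type v} {E : DirectedGraph V Edge}

/-! Contraction yields a finite set `N`, closed under inverses and restrictions, into which every
element of `G` falls on restriction to long paths (`exists_nucleus`). Hence asymptotic equivalence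
of left-infinite paths is the intersection of the relations `NucRel N n` (`leftAsymp_iff`). These
decrease with `n` and are reflexive, symmetric, and transitive up to a bounded loss of index. The
shift lowers the index by one. Regularity, made uniform by compactness, gives the converse for paths
that are already close (`exists_nucRel_succ`), and the action on one more edge lifts related paths
through the shift (`NucRel.exists_lift`).

From such relations one gets a quasi-distance `q ^ n` and from it the chain pseudometric
(`exists_expanding_pseudometric`). Short chains lift link by link through the shift, so the shift
multiplies small distances by exactly `1/q`. The pseudometric vanishes precisely on asymptotic pairs
and descends to an expanding metric on the limit space.

The solenoid is the inverse limit of the limit space along the shift map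
(`isInverseLimit_solenoid`), and the Smale structure exists on every compact inverse limit of a
locally scaling map. The bracket `[s, t]` is the unique point with the zeroth coordinate of `s`
whose coordinates all stay close to those of `t`. Local stable sets lie in fibres of the zeroth
projection. A connected subset of such a fibre is a point, because each fibre of the scaling map is
`ε`-separated.

Irreducibility and mixing hold already for bi-infinite paths: two finite blocks can be joined by a
connecting path (`exists_splice`), and open sets of the solenoid pull back to sets determined
locally by finite blocks. -/

theorem isPath_append_iff {v : V} {μ ν : List Edge} :
    E.IsPath v (μ ++ ν) ↔ E.IsPath v μ ∧ E.IsPath (E.source v μ) ν := by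
  induction μ generalizing v with
  | nil => simp [IsPath, source]
  | cons e μ ih => simp [IsPath, source, ih, and_assoc]

theorem source_append (v : V) (μ ν : List Edge) :
    E.source v (μ ++ ν) = E.source (E.source v μ) ν := by
  induction μ generalizing v with
  | nil => rfl
  | cons e μ ih => exact ih _

theorem NoSources.exists_isPath (hs : E.NoSources) (v : V) (n : ℕ) :
    ∃ μ : List Edge, μ.length = n ∧ E.IsPath v μ := by
  induction n generalizing v with
  | zero => exact ⟨[], rfl, trivial⟩
  | succ n ih =>
    obtain ⟨e, he⟩ := hs v
    obtain ⟨μ, hμ, hp⟩ := ih (E.s e)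
    exact ⟨e :: μ, by simp [hμ], he, hp⟩

end DirectedGraph

/-! ### Calculus of restrictions -/

namespace SelfSimilarAction

variable {V : Type u} {Edge : Type v} {E : DirectedGraph V Edge} [Groupoid.{w} V]
  {A : SelfSimilarAction E}

/-- The unit `v` as an element of `G`. -/
abbrev unitElt (v : V) : GroupoidElt V := ⟨v, v, 𝟙 v⟩

/-- The inverse of an element of `G`. -/
abbrev invElt (g : GroupoidElt V) : GroupoidElt V := ⟨g.2.1, g.1, Groupoid.inv g.2.2⟩

theorem invElt_invElt (g : GroupoidElt V) : invElt (invElt g) = g := by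
  simp [invElt]

theorem eltMul_mk {a b c : V} (g : a ⟶ b) (h : b ⟶ c) :
    eltMul ⟨b, c, h⟩ ⟨a, b, g⟩ = (⟨a, c, g ≫ h⟩ : GroupoidElt V) := by
  simp [eltMul]

theorem MapsTo.isPath_right {g : GroupoidElt V} {μ ν : List Edge} (h : A.MapsTo g μ ν) :
    E.IsPath g.2.1 ν := by
  obtain ⟨h, rfl⟩ := h
  exact (A.act g.2.2 ⟨μ, h⟩).2

theorem MapsTo.unique {g : GroupoidElt V} {μ ν ν' : List Edge} (h : A.MapsTo g μ ν)
    (h' : A.MapsTo g μ ν') : ν = ν' := by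
  obtain ⟨_, rfl⟩ := h
  obtain ⟨_, rfl⟩ := h'
  rfl

theorem exists_mapsTo {g : GroupoidElt V} {μ : List Edge} (h : E.IsPath g.1 μ) :
    ∃ ν, A.MapsTo g μ ν := ⟨_, h, rfl⟩

open Classical in
variable (A) in
/-- The restriction `g|_μ` (and `g` if `μ` is not in the domain of `g`). -/
noncomputable def res (g : GroupoidElt V) (μ : List Edge) : GroupoidElt V :=
  if h : E.IsPath g.1 μ then A.restrictElt g.2.2 ⟨μ, h⟩ else g

theorem res_of_isPath {v w : V} (g : v ⟶ w) (μ : E.PathsTo v) :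
    A.res ⟨v, w, g⟩ μ.1 = A.restrictElt g μ := by
  simp [res, μ.2]

/-- As `g` preserves lengths, the image of `μ ν` splits at the length of `μ`, and the tail is given
by the defining equation of `g|_μ`. This is the working rule for restrictions. -/
theorem mapsTo_append {g : GroupoidElt V} {μ ν κ₁ κ₂ : List Edge} (hl : κ₁.length = μ.length) :
    A.MapsTo g (μ ++ ν) (κ₁ ++ κ₂) ↔ A.MapsTo g μ κ₁ ∧ A.MapsTo (A.res g μ) ν κ₂ := by
  obtain ⟨v, w, g⟩ := g
  constructor
  · rintro ⟨h, hh⟩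
    obtain ⟨h1, h2⟩ := isPath_append_iff.1 h
    have key := A.restrict_spec g ⟨μ, h1⟩ ⟨ν, h2⟩
    have e := hh.symm.trans key
    have hl2 : (A.act g ⟨μ, h1⟩).1.length = μ.length := (A.toPartialIso g).length_map _
    obtain ⟨e1, e2⟩ := List.append_inj e (hl.trans hl2.symm)
    refine ⟨⟨h1, e1.symm⟩, ?_⟩
    rw [res_of_isPath g ⟨μ, h1⟩]
    exact ⟨h2, e2.symm⟩
  · rintro ⟨⟨h1, e1⟩, h2⟩
    rw [res_of_isPath g ⟨μ, h1⟩] at h2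
    obtain ⟨h2, e2⟩ := h2
    refine ⟨isPath_append h1 h2, ?_⟩
    rw [← e1, ← e2]
    exact A.restrict_spec g ⟨μ, h1⟩ ⟨ν, h2⟩

theorem MapsTo.split {g : GroupoidElt V} {μ ν κ : List Edge} (h : A.MapsTo g (μ ++ ν) κ) :
    ∃ κ₁ κ₂, κ = κ₁ ++ κ₂ ∧ κ₁.length = μ.length ∧ A.MapsTo g μ κ₁ ∧
      A.MapsTo (A.res g μ) ν κ₂ := by
  have hl := h.length_eq
  rw [List.length_append] at hl
  have e : κ = κ.take μ.length ++ κ.drop μ.length := (List.take_append_drop _ _).symm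
  have hl' : (κ.take μ.length).length = μ.length := by simp; omega
  refine ⟨_, _, e, hl', ?_⟩
  rw [e] at h
  exact (mapsTo_append hl').1 h

theorem res_fst {g : GroupoidElt V} {μ : List Edge} (h : E.IsPath g.1 μ) :
    (A.res g μ).1 = E.source g.1 μ := by
  rw [res, dif_pos h]; rfl

/-- Faithfulness only compares elements with the same domain and codomain. Without sources there is
an edge in the domain of `g`, and the ranges of this edge and of its image show that the endpoints
agree. -/
theorem elt_ext (hs : E.NoSources) {g h : GroupoidElt V}
    (H : ∀ μ ν, A.MapsTo g μ ν → A.MapsTo h μ ν) : g = h := by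
  obtain ⟨v, w, g⟩ := g
  obtain ⟨v', w', h⟩ := h
  obtain ⟨e, he⟩ := hs v
  obtain ⟨ν, hν⟩ := exists_mapsTo (A := A) (g := ⟨v, w, g⟩) (μ := [e]) ⟨he, trivial⟩
  have hν' := H _ _ hν
  have ev : v = v' := he.symm.trans hν'.1.1
  have ew : w = w' := by
    have h1 := hν.isPath_right
    have h2 := hν'.isPath_right
    have hl := hν.length_eq
    match ν, hl with
    | [f], _ => exact h1.1.symm.trans h2.1
  subst ev ew
  suffices g = h by rw [this]
  refine A.faithful v w (?_ : A.toPartialIso g = A.toPartialIso h)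
  have : (A.toPartialIso g).toEquiv = (A.toPartialIso h).toEquiv := by
    ext μ : 1
    obtain ⟨_, h2⟩ := H μ.1 _ ⟨μ.2, rfl⟩
    exact Subtype.ext h2.symm
  revert this
  generalize A.toPartialIso g = a
  generalize A.toPartialIso h = b
  intro this
  cases a; cases b; cases this; rfl

theorem res_append (hs : E.NoSources) {g : GroupoidElt V} {μ ν : List Edge}
    (h : E.IsPath g.1 (μ ++ ν)) : A.res g (μ ++ ν) = A.res (A.res g μ) ν := by
  refine elt_ext (A := A) hs fun κ κ' hκ => ?_
  obtain ⟨α, hα⟩ := exists_mapsTo (A := A) h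
  have h2 := (mapsTo_append hα.length_eq).2 ⟨hα, hκ⟩
  obtain ⟨α₁, α₂, rfl, hl, h3, h4⟩ := hα.split
  rw [List.append_assoc, List.append_assoc] at h2
  have h5 := ((mapsTo_append hl).1 h2).2
  exact ((mapsTo_append h4.length_eq).1 h5).2

theorem MapsTo.res_inv (hs : E.NoSources) {g : GroupoidElt V} {μ ν : List Edge}
    (h : A.MapsTo g μ ν) : A.res (invElt g) ν = invElt (A.res g μ) := by
  refine elt_ext (A := A) hs fun κ κ' hκ => ?_
  have h2 := (mapsTo_append h.inv.length_eq).2 ⟨h.inv, hκ⟩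
  have h3 := h2.inv
  have e : (⟨(invElt g).2.1, (invElt g).1, Groupoid.inv (invElt g).2.2⟩ : GroupoidElt V) = g := by
    simp
  rw [e] at h3
  exact ((mapsTo_append h.length_eq).1 h3).2.inv

theorem res_unit (hs : E.NoSources) {v : V} {μ : List Edge} (h : E.IsPath v μ) :
    A.res (unitElt v) μ = unitElt (E.source v μ) := by
  symm
  refine elt_ext (A := A) hs fun κ κ' hκ => ?_
  obtain rfl := hκ.unique (mapsTo_id hκ.1)
  exact ((mapsTo_append rfl).1 (mapsTo_id (isPath_append h hκ.1))).2

/-! ### The nucleus -/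

variable (A) in
/-- `N` is a finite subset of `G` that contains the units, is closed under inverses and
restrictions, and contains all restrictions of a given element of `G` to long enough paths. -/
structure IsNucleus (N : Set (GroupoidElt V)) : Prop where
  finite : N.Finite
  unit_mem : ∀ v, unitElt v ∈ N
  inv_mem : ∀ g ∈ N, invElt g ∈ N
  res_mem : ∀ g ∈ N, ∀ μ, E.IsPath g.1 μ → A.res g μ ∈ N
  absorbs : ∀ g, ∃ n : ℕ, ∀ μ, E.IsPath g.1 μ → n ≤ μ.length → A.res g μ ∈ N

theorem finite_paths [Finite Edge] (n : ℕ) : {μ : List Edge | μ.length ≤ n}.Finite :=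
  List.finite_length_le Edge n

/-- The restrictions of elements of the contracting set `F` form a finite set: along a long path one
returns to `F` after boundedly many edges, so the path can be shortened until its length is at most
a constant. Adding inverses and units completes the nucleus. -/
theorem exists_nucleus [Finite V] [Finite Edge] (hs : E.NoSources) (hc : A.IsContracting) :
    ∃ N, A.IsNucleus N := by
  obtain ⟨F, hF, hFc⟩ := hc
  have hFc' : ∀ g : GroupoidElt V, ∃ n : ℕ, ∀ μ, E.IsPath g.1 μ → μ.length = n → A.res g μ ∈ F := by
    rintro ⟨v, w, g⟩
    obtain ⟨n, hn⟩ := hFc v w g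
    refine ⟨n, fun μ hμ hl => ?_⟩
    rw [res_of_isPath g ⟨μ, hμ⟩]
    exact hn _ hl
  choose n hn using hFc'
  -- One edge is read before waiting for the return to `F`, so that the path gets strictly shorter
  -- even if the waiting time is `0`.
  obtain ⟨M, hM⟩ : ∃ M : ℕ, ∀ g ∈ F, ∀ e : Edge, n (A.res g [e]) + 1 ≤ M := by
    have : (Set.image2 (fun g e => n (A.res g [e]) + 1) F (Set.univ : Set Edge)).Finite :=
      hF.image2 _ Set.finite_univ
    obtain ⟨M, hM⟩ := this.bddAbove
    exact ⟨M, fun g hg e => hM ⟨g, hg, e, trivial, rfl⟩⟩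
  let F' : Set (GroupoidElt V) := {h | ∃ g ∈ F, ∃ μ, E.IsPath g.1 μ ∧ h = A.res g μ}
  have key : ∀ (L : ℕ) (g : GroupoidElt V), g ∈ F → ∀ μ, μ.length ≤ L → E.IsPath g.1 μ →
      ∃ g' ∈ F, ∃ μ', μ'.length ≤ M ∧ A.res g μ = A.res g' μ' := by
    intro L
    induction L with
    | zero =>
      intro g hg μ hμ _
      exact ⟨g, hg, μ, by omega, rfl⟩
    | succ L ih =>
      intro g hg μ hμ hp
      by_cases hl : μ.length ≤ M
      · exact ⟨g, hg, μ, hl, rfl⟩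
      match μ, hp, hμ, hl with
      | [], _, _, hl => simp at hl
      | e :: μ, hp, hμ, hl =>
        have hM' := hM g hg e
        simp only [List.length_cons] at hμ hl
        have hp1 : E.IsPath g.1 ([e] ++ μ) := hp
        have hp2 : E.IsPath (A.res g [e]).1 μ := by
          rw [res_fst (isPath_append_iff.1 hp1).1]
          exact (isPath_append_iff.1 hp1).2
        set m := n (A.res g [e]) with hm
        have e1 : μ = μ.take m ++ μ.drop m := (List.take_append_drop _ _).symm
        have hp3 : E.IsPath (A.res g [e]).1 (μ.take m ++ μ.drop m) := by rwa [← e1]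
        have hp4 := isPath_append_iff.1 hp3
        have hF2 := hn (A.res g [e]) (μ.take m) hp4.1 (by simp; omega)
        obtain ⟨g', hg', μ', hμ', h'⟩ := ih _ hF2 (μ.drop m) (by simp; omega)
          (by rw [res_fst hp4.1]; exact hp4.2)
        refine ⟨g', hg', μ', hμ', ?_⟩
        rw [← h', ← res_append hs hp3, ← e1]
        exact res_append hs hp1
  have hF'fin : F'.Finite := by
    refine (hF.image2 (fun g μ => A.res g μ) (finite_paths (Edge := Edge) M)).subset ?_
    rintro _ ⟨g, hg, μ, hp, rfl⟩
    obtain ⟨g', hg', μ', hμ', h'⟩ := key _ g hg μ le_rfl hp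
    exact ⟨g', hg', μ', hμ', h'.symm⟩
  have hF'res : ∀ g ∈ F', ∀ μ, E.IsPath g.1 μ → A.res g μ ∈ F' := by
    rintro _ ⟨g, hg, μ, hp, rfl⟩ ν hν
    rw [res_fst hp] at hν
    have := isPath_append hp hν
    exact ⟨g, hg, μ ++ ν, this, (res_append hs this).symm⟩
  refine ⟨F' ∪ invElt '' F' ∪ Set.range unitElt,
    (hF'fin.union (hF'fin.image _)).union (Set.finite_range _), fun v => Or.inr ⟨v, rfl⟩, ?_, ?_, ?_⟩
  · rintro g ((hg | ⟨g, hg, rfl⟩) | ⟨v, rfl⟩)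
    · exact Or.inl (Or.inr ⟨g, hg, rfl⟩)
    · left; left; rwa [invElt_invElt]
    · right; exact ⟨v, by simp⟩
  · rintro g ((hg | ⟨g, hg, rfl⟩) | ⟨v, rfl⟩) μ hμ
    · exact Or.inl (Or.inl (hF'res g hg μ hμ))
    · left; right
      obtain ⟨ν, hν⟩ := exists_mapsTo (A := A) hμ
      have h1 := hν.inv
      have e : (⟨(invElt g).2.1, (invElt g).1, Groupoid.inv (invElt g).2.2⟩ : GroupoidElt V) = g := by
        simp
      rw [e] at h1
      exact ⟨_, hF'res g hg ν h1.1, (h1.res_inv hs).symm⟩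
    · right; exact ⟨_, (res_unit hs hμ).symm⟩
  · intro g
    refine ⟨n g, fun μ hμ hl => Or.inl (Or.inl ?_)⟩
    have e1 : μ = μ.take (n g) ++ μ.drop (n g) := (List.take_append_drop _ _).symm
    rw [e1] at hμ ⊢
    have hp := isPath_append_iff.1 hμ
    refine ⟨_, hn g (μ.take (n g)) hp.1 (by simp; omega), μ.drop (n g), ?_, res_append hs hμ⟩
    rw [res_fst hp.1]; exact hp.2

theorem IsNucleus.exists_absorbs {N : Set (GroupoidElt V)} (hN : A.IsNucleus N)
    {P : Set (GroupoidElt V)} (hP : P.Finite) :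
    ∃ n : ℕ, ∀ g ∈ P, ∀ μ, E.IsPath g.1 μ → n ≤ μ.length → A.res g μ ∈ N := by
  choose n hn using hN.absorbs
  obtain ⟨M, hM⟩ := (hP.image n).bddAbove
  exact ⟨M, fun g hg μ hμ hl => hn g μ hμ ((hM ⟨g, hg, rfl⟩).trans hl)⟩

/-! ### Uniform regularity -/

theorem res_eq_unit_of_prefix (hs : E.NoSources) {g : GroupoidElt V} {μ ν : List Edge} {v : V}
    (h : E.IsPath g.1 (μ ++ ν)) (hu : A.res g μ = unitElt v) :
    ∃ v, A.res g (μ ++ ν) = unitElt v := by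
  have hp := isPath_append_iff.1 h
  rw [← res_fst (A := A) hp.1, hu] at hp
  rw [res_append hs h, hu]
  exact ⟨_, res_unit hs hp.2⟩

/-- A compactness argument: if no bound existed, the sequences whose first `k` edges are fixed by
`p` with non-unit restriction would form decreasing non-empty closed sets. A common point would be
an infinite path violating regularity. -/
theorem exists_bound_of_isRegular [Finite Edge] (hs : E.NoSources) (hr : A.IsRegular)
    (p : GroupoidElt V) :
    ∃ k : ℕ, ∀ μ, k ≤ μ.length → A.MapsTo p μ μ → ∃ v, A.res p μ = unitElt v := by
  by_contra! H
  let _ : TopologicalSpace Edge := ⊥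
  have : DiscreteTopology Edge := ⟨rfl⟩
  let w : (ℕ → Edge) → ℕ → List Edge := fun y k => (List.range k).map y
  let C : ℕ → Set (ℕ → Edge) := fun k =>
    {y | A.MapsTo p (w y k) (w y k) ∧ ∀ v, A.res p (w y k) ≠ unitElt v}
  have hwsucc : ∀ y k, w y (k + 1) = w y k ++ [y k] := by
    intro y k; simp [w, List.range_succ]
  have hanti : ∀ k, C (k + 1) ⊆ C k := by
    rintro k y ⟨h1, h2⟩
    rw [hwsucc] at h1 h2
    refine ⟨h1.of_concat, fun v hv => ?_⟩
    obtain ⟨v', hv'⟩ := res_eq_unit_of_prefix hs h1.1 hv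
    exact h2 v' hv'
  have hne : ∀ k, (C k).Nonempty := by
    intro k
    obtain ⟨μ, hk, h1, h2⟩ := H (k + 1)
    have hne : 0 < μ.length := by omega
    -- The values beyond `μ` are irrelevant and `y` need not be a path; asking for length at least
    -- `k + 1` makes `μ[0]` available.
    let y : ℕ → Edge := fun i => if h : i < μ.length then μ[i] else μ[0]
    have hw : w y μ.length = μ := by
      apply List.ext_getElem
      · simp [w]
      · intro i h3 h4
        simp [w, y, h4]
    have hy : y ∈ C μ.length := by
      refine ⟨?_, ?_⟩
      · rw [hw]; exact h1
      · rw [hw]; exact h2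
    exact ⟨y, antitone_nat_of_succ_le hanti (by omega : k ≤ μ.length) hy⟩
  have hclosed : ∀ k, IsClosed (C k) := by
    intro k
    have hc : Continuous fun y : ℕ → Edge => (fun i : Fin k => y i) := by fun_prop
    have : C k = (fun y : ℕ → Edge => (fun i : Fin k => y i)) ⁻¹'
        {z | A.MapsTo p (List.ofFn z) (List.ofFn z) ∧ ∀ v, A.res p (List.ofFn z) ≠ unitElt v} := by
      ext y
      have : List.ofFn (fun i : Fin k => y i) = w y k := by
        apply List.ext_getElem <;> simp [w]
      simp only [Set.mem_preimage, Set.mem_ofPred_eq, this, C]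
    rw [this]
    exact (isClosed_discrete _).preimage hc
  obtain ⟨y, hy⟩ := IsCompact.nonempty_iInter_of_sequence_nonempty_isCompact_isClosed C hanti hne
    (hclosed 0).isCompact hclosed
  rw [Set.mem_iInter] at hy
  have hchain : ∀ k, E.s (y k) = E.r (y (k + 1)) := by
    intro k
    have h1 := (hy (k + 2)).1.1
    rw [hwsucc, hwsucc] at h1
    have h2 := (isPath_append_iff.1 h1).2
    rw [source_append] at h2
    exact h2.1.symm
  let Y : E.RightPath := ⟨y, hchain⟩
  have hY : ∀ k, Y.initial k = w y k := fun _ => rfl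
  have hfix := fun k => (hy k).1
  have hbad := fun k => (hy k).2
  have hv : p.1 = Y.range := (hfix 1).1.1.symm
  have hw' : p.2.1 = Y.range := (hfix 1).isPath_right.1.symm
  obtain ⟨a, b, p⟩ := p
  dsimp only at hv hw'
  subst hv hw'
  obtain ⟨n, -, hn⟩ := hr Y p (fun n => Subtype.ext (hfix n).2)
  exact hbad n _ ((res_of_isPath p ⟨Y.initial n, Y.isPath_initial n⟩).trans hn)

/-- Two elements of a finite set which agree on a long path `μ` have the same restriction to
`μ`. -/
theorem exists_bound_eq_of_isRegular [Finite Edge] (hs : E.NoSources) (hr : A.IsRegular)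
    {N : Set (GroupoidElt V)} (hN : N.Finite) :
    ∃ k : ℕ, ∀ g ∈ N, ∀ h ∈ N, ∀ μ ν μ' ν', k ≤ μ.length → A.MapsTo g μ ν → A.MapsTo h μ ν →
      A.MapsTo g (μ ++ μ') ν' → A.MapsTo h (μ ++ μ') ν' := by
  choose k hk using exists_bound_of_isRegular (A := A) hs hr
  have hfin : (Set.image2 (fun g h => k (eltMul (invElt h) g)) N N).Finite := hN.image2 _ hN
  obtain ⟨M, hM⟩ := hfin.bddAbove
  -- The extra `1` makes `μ` non-empty: an empty list does not determine its vertex, so it could not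
  -- certify that elements are composable.
  refine ⟨M + 1, fun g hg h hh μ ν μ' ν' hl h1 h2 h3 => ?_⟩
  have hne : μ ≠ [] := by rintro rfl; simp at hl
  have h4 := MapsTo.mul hne h1 h2.inv
  have hb : k (eltMul (invElt h) g) ≤ M := hM ⟨g, hg, h, hh, rfl⟩
  obtain ⟨v, hv⟩ := hk _ μ (hb.trans (by omega)) h4
  obtain ⟨κ, hκ⟩ := exists_mapsTo (A := A) (g := eltMul (invElt h) g) (μ := μ ++ μ') (by
    have e : (eltMul (invElt h) g).1 = g.1 := by unfold eltMul; split_ifs <;> rfl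
    rw [e]; exact h3.1)
  obtain ⟨κ₁, κ₂, rfl, hl', h5, h6⟩ := hκ.split
  obtain rfl := h4.unique h5
  rw [hv] at h6
  obtain rfl := (mapsTo_id h6.1).unique h6
  obtain ⟨κ, hκ'⟩ := exists_mapsTo (A := A) (g := h) (μ := μ ++ μ') (by
    have : h.1 = g.1 := by
      cases μ with
      | nil => exact absurd rfl hne
      | cons e μ => exact h2.1.1.symm.trans h1.1.1
    rw [this]; exact h3.1)
  have hne' : ν' ≠ [] := by
    rintro rfl
    have := h3.length_eq
    rw [List.length_append, List.length_nil] at this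
    omega
  -- Since `h⁻¹ g` fixes `μ μ'`, the product `h (h⁻¹ g) g⁻¹` sends `g · (μ μ')` to `h · (μ μ')`; but
  -- this product is a unit.
  have h8 := MapsTo.mul hne' (MapsTo.mul hne' h3.inv hκ) hκ'
  have e : eltMul h (eltMul (eltMul (invElt h) g) (invElt g)) = unitElt g.2.1 := by
    have e1 : g.1 = h.1 := by
      cases μ with
      | nil => exact absurd rfl hne
      | cons e μ => exact h1.1.1.symm.trans h2.1.1
    have e2 : g.2.1 = h.2.1 := by
      have h1' := h1.isPath_right
      have h2' := h2.isPath_right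
      have := h1.length_eq
      cases ν with
      | nil => exact absurd (List.length_eq_zero_iff.1 this.symm) hne
      | cons e μ => exact h1'.1.symm.trans h2'.1
    obtain ⟨a, b, g⟩ := g
    obtain ⟨a', b', h⟩ := h
    dsimp only at e1 e2
    subst e1 e2
    show eltMul ⟨a, b, h⟩ (eltMul (eltMul ⟨b, a, Groupoid.inv h⟩ ⟨a, b, g⟩)
      ⟨b, a, Groupoid.inv g⟩) = _
    rw [eltMul_mk, eltMul_mk, eltMul_mk]
    simp
  rw [e] at h8
  obtain rfl := (mapsTo_id h8.1).unique h8
  exact hκ'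

end SelfSimilarAction

/-! ### Left-infinite paths and the relations given by the nucleus -/

namespace DirectedGraph

variable {V : Type u} {Edge : Type v} {E : DirectedGraph V Edge}

@[simp]
theorem LeftPath.length_final (x : E.LeftPath) (n : ℕ) : (x.final n).length = n := by
  simp [LeftPath.final]

theorem LeftPath.final_add (x : E.LeftPath) (n m : ℕ) :
    ∃ μ : List Edge, μ.length = m ∧ x.final (n + m) = μ ++ x.final n := by
  refine ⟨(List.range m).reverse.map fun i => x.edge (n + i), by simp, ?_⟩
  simp [LeftPath.final, List.range_add, List.map_reverse, Function.comp_def]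

theorem LeftPath.exists_isPath_final (x : E.LeftPath) (n : ℕ) : ∃ v, E.IsPath v (x.final n) := by
  cases n with
  | zero => exact ⟨E.r (x.edge 0), by simp [LeftPath.final, IsPath]⟩
  | succ n => exact ⟨_, x.isPath_final n⟩

theorem LeftPath.source_final (x : E.LeftPath) (v : V) (n : ℕ) :
    E.source v (x.final (n + 1)) = E.s (x.edge 0) := by
  rw [LeftPath.final_shift, source_append]
  rfl

/-- The left-infinite path `x e`. -/
def LeftPath.snoc (x : E.LeftPath) (e : Edge) (h : E.s (x.edge 0) = E.r e) : E.LeftPath where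
  edge
    | 0 => e
    | k + 1 => x.edge k
  chain
    | 0 => h
    | k + 1 => x.chain k

end DirectedGraph

namespace SelfSimilarAction

variable {V : Type u} {Edge : Type v} {E : DirectedGraph V Edge} [Groupoid.{w} V]
  {A : SelfSimilarAction E}

variable (A) in
/-- Some element of `N` maps `x₋ₙ … x₋₁` to `y₋ₙ … y₋₁`. -/
def NucRel (N : Set (GroupoidElt V)) (n : ℕ) (x y : E.LeftPath) : Prop :=
  ∃ g ∈ N, A.MapsTo g (x.final n) (y.final n)

variable {N : Set (GroupoidElt V)}

theorem MapsTo.final_of_add {g : GroupoidElt V} {x y : E.LeftPath} {n m : ℕ}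
    (h : A.MapsTo g (x.final (n + m)) (y.final (n + m))) :
    ∃ μ, E.IsPath g.1 μ ∧ μ.length = m ∧ A.MapsTo (A.res g μ) (x.final n) (y.final n) := by
  obtain ⟨μ, hμ, e⟩ := x.final_add n m
  obtain ⟨ν, hν, e'⟩ := y.final_add n m
  rw [e, e', mapsTo_append (hν.trans hμ.symm)] at h
  exact ⟨μ, h.1.1, hμ, h.2⟩

theorem IsNucleus.nucRel_anti (hN : A.IsNucleus N) {x y : E.LeftPath} {n m : ℕ} (hnm : n ≤ m)
    (h : A.NucRel N m x y) : A.NucRel N n x y := by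
  obtain ⟨k, rfl⟩ := Nat.exists_eq_add_of_le hnm
  obtain ⟨g, hg, h⟩ := h
  obtain ⟨μ, hp, -, h⟩ := h.final_of_add
  exact ⟨_, hN.res_mem g hg μ hp, h⟩

theorem IsNucleus.nucRel_of_final_eq (hN : A.IsNucleus N) {x y : E.LeftPath} {n : ℕ}
    (h : x.final n = y.final n) : A.NucRel N n x y := by
  obtain ⟨v, hv⟩ := x.exists_isPath_final n
  exact ⟨_, hN.unit_mem v, h ▸ mapsTo_id hv⟩

theorem IsNucleus.nucRel_zero (hN : A.IsNucleus N) (x y : E.LeftPath) : A.NucRel N 0 x y :=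
  hN.nucRel_of_final_eq (by simp [LeftPath.final])

theorem IsNucleus.nucRel_symm (hN : A.IsNucleus N) {x y : E.LeftPath} {n : ℕ}
    (h : A.NucRel N n x y) : A.NucRel N n y x := by
  obtain ⟨g, hg, h⟩ := h
  exact ⟨_, hN.inv_mem g hg, h.inv⟩

/-- Products of three elements of `N` form a finite set, so a fixed number `m` of edges brings all
of them back into `N`. Three factors are what the four-point inequality for the chain metric
requires. -/
theorem IsNucleus.exists_nucRel_trans (hN : A.IsNucleus N) :
    ∃ m : ℕ, ∀ (n : ℕ) (x₁ x₂ x₃ x₄ : E.LeftPath), A.NucRel N (n + m) x₁ x₂ →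
      A.NucRel N (n + m) x₂ x₃ → A.NucRel N (n + m) x₃ x₄ → A.NucRel N n x₁ x₄ := by
  obtain ⟨m, hm⟩ := hN.exists_absorbs
    (hN.finite.image2 eltMul (hN.finite.image2 eltMul hN.finite))
  refine ⟨m, fun n x₁ x₂ x₃ x₄ h₁ h₂ h₃ => ?_⟩
  rcases Nat.eq_zero_or_pos n with rfl | hn
  · exact hN.nucRel_zero _ _
  obtain ⟨g₁, hg₁, h₁⟩ := h₁
  obtain ⟨g₂, hg₂, h₂⟩ := h₂
  obtain ⟨g₃, hg₃, h₃⟩ := h₃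
  have hne : x₁.final (n + m) ≠ [] := by
    intro h0
    have := congrArg List.length h0
    simp at this
    omega
  obtain ⟨μ, hp, hμ, h⟩ := (MapsTo.mul hne (MapsTo.mul hne h₁ h₂) h₃).final_of_add
  exact ⟨_, hm _ ⟨g₃, hg₃, _, ⟨g₂, hg₂, g₁, hg₁, rfl⟩, rfl⟩ μ hp hμ.ge, h⟩

theorem NucRel.shift {x y : E.LeftPath} {n : ℕ} (h : A.NucRel N (n + 1) x y) :
    A.NucRel N n x.shift y.shift := by
  obtain ⟨g, hg, h⟩ := h
  rw [LeftPath.final_shift, LeftPath.final_shift y] at h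
  exact ⟨g, hg, h.of_concat⟩

/-- The element relating the shifts at level `n` restricts to an element of `N` that agrees with
`h₀` on `k` edges. By uniform regularity both then act alike on the last edge, where `h₀` is known
to be correct. -/
theorem IsNucleus.exists_nucRel_succ [Finite Edge] (hs : E.NoSources) (hr : A.IsRegular)
    (hN : A.IsNucleus N) :
    ∃ k : ℕ, ∀ x y : E.LeftPath, A.NucRel N (k + 1) x y → ∀ n : ℕ,
      A.NucRel N n x.shift y.shift → A.NucRel N (n + 1) x y := by
  obtain ⟨k, hk⟩ := exists_bound_eq_of_isRegular hs hr hN.finite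
  refine ⟨k, fun x y hxy n h => ?_⟩
  rcases le_total n k with hnk | hnk
  · exact hN.nucRel_anti (by omega) hxy
  obtain ⟨m, rfl⟩ := Nat.exists_eq_add_of_le hnk
  obtain ⟨h₀, hh₀, hxy⟩ := hxy
  obtain ⟨g, hg, h⟩ := h
  refine ⟨g, hg, ?_⟩
  rw [LeftPath.final_shift, LeftPath.final_shift y] at hxy ⊢
  obtain ⟨μ, hμ, e⟩ := x.shift.final_add k m
  obtain ⟨ν, hν, e'⟩ := y.shift.final_add k m
  have hl := hν.trans hμ.symm
  rw [e, e', mapsTo_append hl] at h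
  rw [e, e', List.append_assoc, List.append_assoc, mapsTo_append hl]
  exact ⟨h.1, hk h₀ hh₀ _ (hN.res_mem g hg μ h.1.1) _ _ _ _ (by simp) hxy.of_concat h.2 hxy⟩

/-- The group element that carries the end of `x.shift` to that of `u` also acts on the last edge of
`x`; appending the image edge to `u` gives the lift. -/
theorem NucRel.exists_lift {x u : E.LeftPath} {n : ℕ} (h : A.NucRel N (n + 1) x.shift u) :
    ∃ y : E.LeftPath, y.shift = u ∧ A.NucRel N (n + 2) x y := by
  obtain ⟨g, hg, h⟩ := h
  have hp : E.IsPath g.1 (x.shift.final (n + 1) ++ [x.edge 0]) := by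
    refine isPath_append h.1 ?_
    rw [LeftPath.source_final]
    exact ⟨(x.chain 0).symm, trivial⟩
  obtain ⟨κ, hκ⟩ := exists_mapsTo (A := A) hp
  obtain ⟨κ₁, κ₂, rfl, -, h1, h2⟩ := hκ.split
  obtain rfl := h.unique h1
  match κ₂, h2.length_eq with
  | [f], _ =>
    have h3 := (isPath_append_iff.1 hκ.isPath_right).2
    rw [LeftPath.source_final] at h3
    refine ⟨u.snoc f h3.1.symm, rfl, g, hg, ?_⟩
    rw [LeftPath.final_shift, LeftPath.final_shift (u.snoc f _)]
    exact hκ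

/-- Finitely many group elements are absorbed by `N` after a common number `m` of edges, so the
element needed at level `n` is found by starting `m` edges further to the left. Conversely, any
choice from `N` has finitely many values. -/
theorem IsNucleus.leftAsymp_iff (hN : A.IsNucleus N) {x y : E.LeftPath} :
    A.LeftAsymp x y ↔ ∀ n, A.NucRel N n x y := by
  constructor
  · rintro ⟨g, hg, h⟩ n
    obtain ⟨m, hm⟩ := hN.exists_absorbs hg
    have h' := h (n + m)
    rw [show n + m + 1 = n + 1 + m by omega] at h'
    obtain ⟨μ, hp, hμ, h⟩ := h'.final_of_add
    exact hN.nucRel_anti n.le_succ ⟨_, hm _ ⟨_, rfl⟩ μ hp hμ.ge, h⟩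
  · intro h
    choose g hg h using h
    exact ⟨fun n => g (n + 1), hN.finite.subset (by rintro _ ⟨n, rfl⟩; exact hg _),
      fun n => h (n + 1)⟩

end SelfSimilarAction

/-! ### An expanding pseudometric from a scale of relations -/

section ScaleDist

open scoped NNReal

variable {X : Type*} {R : ℕ → X → X → Prop} {q : ℝ≥0}

open Classical in
variable (R q) in
/-- `q ^ n` for the largest `n` such that `R n x y`, and `0` if `R n x y` for all `n`. -/
noncomputable def scaleDist (x y : X) : ℝ≥0 :=
  if h : ∃ n, ¬ R (n + 1) x y then q ^ Nat.find h else 0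

theorem scaleDist_eq_zero_or_pow (x y : X) :
    scaleDist R q x y = 0 ∨ ∃ n : ℕ, scaleDist R q x y = q ^ n := by
  unfold scaleDist
  split_ifs
  · exact Or.inr ⟨_, rfl⟩
  · exact Or.inl rfl

theorem scaleDist_le_pow_iff (hq : 0 < q) (hq1 : q < 1) (h0 : ∀ x y, R 0 x y)
    (hanti : ∀ n x y, R (n + 1) x y → R n x y) {x y : X} {n : ℕ} :
    scaleDist R q x y ≤ q ^ n ↔ R n x y := by
  classical
  have hle : ∀ {a b : ℕ}, a ≤ b → R b x y → R a x y := by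
    intro a b hab
    induction b, hab using Nat.le_induction with
    | base => exact id
    | succ b _ ih => exact fun h => ih (hanti _ _ _ h)
  unfold scaleDist
  split_ifs with h
  · rw [pow_le_pow_iff_right_of_lt_one₀ hq hq1]
    constructor
    · intro hn
      cases n with
      | zero => exact h0 x y
      | succ n => exact not_not.1 (Nat.find_min h hn)
    · intro hR
      by_contra hn
      exact Nat.find_spec h (hle (by omega) hR)
  · push Not at h
    refine ⟨fun _ => ?_, fun _ => zero_le⟩
    cases n with
    | zero => exact h0 x y
    | succ n => exact h n

/-- Values of `scaleDist` are `0` or powers of `q`, so estimates can be tested level by level, with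
a limit when `b = 0`. -/
theorem le_mul_of_forall_le_pow (hq1 : q < 1) {a b r : ℝ≥0} (hb : b = 0 ∨ ∃ n : ℕ, b = q ^ n)
    (h : ∀ n : ℕ, b ≤ q ^ n → a ≤ r * q ^ n) : a ≤ r * b := by
  rcases hb with rfl | ⟨n, rfl⟩
  · have ht : Tendsto (fun n : ℕ => r * q ^ n) atTop (𝓝 (r * 0)) :=
      (NNReal.tendsto_pow_atTop_nhds_zero_of_lt_one hq1).const_mul r
    exact ge_of_tendsto' ht fun n => h n zero_le
  · exact h n le_rfl

/-- `StepChain D x y t`: there is a finite chain from `x` to `y` whose steps have total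
`D`-length `t`. -/
inductive StepChain (D : X → X → ℝ≥0) : X → X → ℝ≥0 → Prop
  | nil (x : X) : StepChain D x x 0
  | cons (x : X) {y z : X} {t : ℝ≥0} (h : StepChain D y z t) : StepChain D x z (D x y + t)

/-- Turns the list sums in the definition of the chain pseudometric into chains that allow
induction. -/
theorem stepChain_zipWith (D : X → X → ℝ≥0) (l : List X) (x y : X) :
    StepChain D x y (((x :: l).zipWith D (l ++ [y])).sum) := by
  induction l generalizing x with
  | nil => simpa using StepChain.cons (D := D) x (StepChain.nil y)
  | cons z l ih => exact StepChain.cons x (ih z)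

/-- A self-map which is expanding with respect to a decreasing sequence of approximately transitive
relations scales some pseudometric by a constant factor at small distances. -/
theorem exists_expanding_pseudometric (σ : X → X) (h0 : ∀ x y, R 0 x y)
    (hanti : ∀ n x y, R (n + 1) x y → R n x y) (hrefl : ∀ n x, R n x x)
    (hsymm : ∀ n x y, R n x y → R n y x) {m : ℕ}
    (htrans : ∀ (n : ℕ) (x₁ x₂ x₃ x₄ : X), R (n + m) x₁ x₂ → R (n + m) x₂ x₃ →
      R (n + m) x₃ x₄ → R n x₁ x₄)
    (hshift : ∀ n x y, R (n + 1) x y → R n (σ x) (σ y)) {k : ℕ}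
    (hsucc : ∀ x y, R (k + 1) x y → ∀ n, R n (σ x) (σ y) → R (n + 1) x y)
    (hlift : ∀ n x u, R (n + 1) (σ x) u → ∃ y, σ y = u ∧ R (n + 2) x y) :
    ∃ (d : X → X → ℝ) (ε c : ℝ), (∀ x, d x x = 0) ∧ (∀ x y, d x y = d y x) ∧
      (∀ x y z, d x z ≤ d x y + d y z) ∧ (∀ x y, d x y = 0 ↔ ∀ n, R n x y) ∧
      (∀ δ > 0, ∃ n, ∀ x y, R n x y → d x y < δ) ∧ 0 < ε ∧ 1 < c ∧
      (∀ x y, d x y < ε → d (σ x) (σ y) = c * d x y) ∧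
      (∀ x w α, α ≤ ε → d (σ x) w < c * α → ∃ y, σ y = w ∧ d x y < α) := by
  -- `q` is so close to `1` that losing `m` levels costs at most a factor `2`.
  obtain ⟨q, hq, hq1, hqm⟩ : ∃ q : ℝ≥0, 0 < q ∧ q < 1 ∧ 1 ≤ 2 * q ^ m := by
    have hc : ContinuousAt (fun q : ℝ => 2 * q ^ m) 1 := by fun_prop
    have h1 : ∀ᶠ q : ℝ in 𝓝 1, 1 < 2 * q ^ m := hc.eventually (lt_mem_nhds (by simp))
    have h2 : ∀ᶠ q : ℝ in 𝓝 1, 0 < q := lt_mem_nhds one_pos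
    obtain ⟨q, ⟨h3, h4⟩, h5⟩ := (((h1.and h2).filter_mono nhdsWithin_le_nhds).and
      (self_mem_nhdsWithin (s := Set.Iio 1))).exists
    lift q to ℝ≥0 using h4.le
    exact ⟨q, by exact_mod_cast h4, by exact_mod_cast (h5 : (q : ℝ) < 1),
      by exact_mod_cast h3.le⟩
  set D : X → X → ℝ≥0 := scaleDist R q with hD
  have hDle : ∀ {x y : X} {n : ℕ}, D x y ≤ q ^ n ↔ R n x y :=
    scaleDist_le_pow_iff hq hq1 h0 hanti
  have hDpow : ∀ x y, D x y = 0 ∨ ∃ n : ℕ, D x y = q ^ n := scaleDist_eq_zero_or_pow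
  have hDzero : ∀ x y, D x y = 0 ↔ ∀ n, R n x y := by
    intro x y
    refine ⟨fun h n => hDle.1 (h ▸ zero_le), fun h => ?_⟩
    have := le_mul_of_forall_le_pow hq1 (a := D x y) (b := 0) (r := 1) (Or.inl rfl)
      fun n _ => by rw [one_mul]; exact hDle.2 (h n)
    simpa using this
  have hD0 : ∀ x, D x x = 0 := fun x => (hDzero x x).2 fun n => hrefl n x
  have hDle' : ∀ x y, D x y ≤ D y x := by
    intro x y
    have := le_mul_of_forall_le_pow hq1 (a := D x y) (r := 1) (hDpow y x)
      fun n h => by rw [one_mul]; exact hDle.2 (hsymm _ _ _ (hDle.1 h))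
    simpa using this
  have hDc : ∀ x y, D x y = D y x := fun x y => le_antisymm (hDle' x y) (hDle' y x)
  -- This inequality is what makes the chain pseudometric comparable to `D`, namely `dist ≤ D ≤ 2 *
  -- dist`.
  have hD4 : ∀ x₁ x₂ x₃ x₄, D x₁ x₄ ≤ 2 * max (D x₁ x₂) (max (D x₂ x₃) (D x₃ x₄)) := by
    intro x₁ x₂ x₃ x₄
    have hmax : ∀ a b : ℝ≥0, (a = 0 ∨ ∃ n : ℕ, a = q ^ n) → (b = 0 ∨ ∃ n : ℕ, b = q ^ n) →
        (max a b = 0 ∨ ∃ n : ℕ, max a b = q ^ n) := by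
      intro a b ha hb
      rcases max_choice a b with h | h <;> rw [h] <;> assumption
    refine le_mul_of_forall_le_pow hq1
      (hmax _ _ (hDpow _ _) (hmax _ _ (hDpow _ _) (hDpow _ _))) fun n hn => ?_
    simp only [max_le_iff] at hn
    rcases le_total m n with hmn | hmn
    · obtain ⟨j, rfl⟩ := Nat.exists_eq_add_of_le hmn
      rw [Nat.add_comm] at hn
      have h := hDle.2 (htrans j x₁ x₂ x₃ x₄ (hDle.1 hn.1) (hDle.1 hn.2.1) (hDle.1 hn.2.2))
      calc D x₁ x₄ ≤ 1 * q ^ j := by rwa [one_mul]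
        _ ≤ 2 * q ^ m * q ^ j := by gcongr
        _ = 2 * q ^ (m + j) := by rw [pow_add, mul_assoc]
    · calc D x₁ x₄ ≤ q ^ 0 := hDle.2 (h0 _ _)
        _ = 1 := pow_zero q
        _ ≤ 2 * q ^ m := hqm
        _ ≤ 2 * q ^ n := by gcongr 2 * ?_; exact pow_le_pow_of_le_one zero_le hq1.le hmn
  let _ : PseudoMetricSpace X := PseudoMetricSpace.ofPreNNDist D hD0 hDc
  have hdD : ∀ x y, dist x y ≤ D x y := PseudoMetricSpace.dist_ofPreNNDist_le D hD0 hDc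
  have hDd : ∀ x y, (D x y : ℝ) ≤ 2 * dist x y :=
    PseudoMetricSpace.le_two_mul_dist_ofPreNNDist D hD0 hDc hD4
  have hdchain : ∀ {x y : X} {t : ℝ}, dist x y < t → ∃ s : ℝ≥0, s < t ∧ StepChain D x y s := by
    intro x y t h
    rw [PseudoMetricSpace.dist_ofPreNNDist D hD0 hDc] at h
    have ht : 0 ≤ t := le_trans (NNReal.coe_nonneg _) h.le
    lift t to ℝ≥0 using ht
    obtain ⟨l, hl⟩ := exists_lt_of_ciInf_lt (NNReal.coe_lt_coe.1 h)
    exact ⟨_, NNReal.coe_lt_coe.2 hl, stepChain_zipWith D l x y⟩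
  have hqR : (0 : ℝ) < q := NNReal.coe_pos.2 hq
  have hDσ : ∀ x y, (q : ℝ) * D (σ x) (σ y) ≤ D x y := by
    intro x y
    have := le_mul_of_forall_le_pow hq1 (a := q * D (σ x) (σ y)) (r := 1) (hDpow x y)
      fun n h => by
        rw [one_mul]
        cases n with
        | zero =>
          have : D (σ x) (σ y) ≤ q ^ 0 := hDle.2 (h0 _ _)
          calc q * D (σ x) (σ y) ≤ 1 * q ^ 0 := by gcongr
            _ = q ^ 0 := one_mul _
        | succ n =>
          rw [pow_succ']
          gcongr
          exact hDle.2 (hshift _ _ _ (hDle.1 h))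
    rw [one_mul] at this
    exact_mod_cast this
  have hdσ : ∀ x y, (q : ℝ) * dist (σ x) (σ y) ≤ dist x y := by
    intro x y
    refine le_of_forall_gt_imp_ge_of_dense fun t ht => ?_
    obtain ⟨s, hs, hch⟩ := hdchain ht
    refine le_trans ?_ hs.le
    clear hs ht
    induction hch with
    | nil x => simp
    | @cons x y z t h ih =>
      calc (q : ℝ) * dist (σ x) (σ z) ≤ q * (dist (σ x) (σ y) + dist (σ y) (σ z)) := by
            gcongr; exact dist_triangle _ _ _
        _ = q * dist (σ x) (σ y) + q * dist (σ y) (σ z) := mul_add _ _ _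
        _ ≤ q * D (σ x) (σ y) + t := by gcongr; exact hdD _ _
        _ ≤ D x y + t := by gcongr; exact hDσ _ _
        _ = ((D x y + t : ℝ≥0) : ℝ) := by push_cast; rfl
  have hDlift : ∀ x u, D (σ x) u ≤ q ^ (k + 1) → ∃ y, σ y = u ∧ D x y ≤ q * D (σ x) u := by
    intro x u h
    obtain ⟨y, rfl, hy⟩ := hlift k x u (hDle.1 h)
    refine ⟨y, rfl, le_mul_of_forall_le_pow hq1 (hDpow _ _) fun n hn => ?_⟩
    rw [← pow_succ']
    exact hDle.2 (hsucc x y (hanti _ _ _ hy) n (hDle.1 hn))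
  -- The bound on the total length bounds every link, so each link lifts in turn and shrinks by the
  -- factor `q`.
  have hchlift : ∀ {u w : X} {t : ℝ≥0}, StepChain D u w t → t ≤ q ^ (k + 1) → ∀ x, σ x = u →
      ∃ y, σ y = w ∧ dist x y ≤ q * t := by
    intro u w t h
    induction h with
    | nil u => exact fun _ x hx => ⟨x, hx, by simp⟩
    | @cons u v w t h ih =>
      rintro ht x rfl
      obtain ⟨y, rfl, hy⟩ := hDlift x v (le_self_add.trans ht)
      obtain ⟨z, rfl, hz⟩ := ih (le_add_self.trans ht) y rfl
      refine ⟨z, rfl, (dist_triangle x y z).trans ?_⟩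
      have hy' : (D x y : ℝ) ≤ q * D (σ x) (σ y) := by exact_mod_cast hy
      have := hdD x y
      push_cast
      linarith
  have hinj : ∀ y y', σ y = σ y' → 2 * dist y y' ≤ q ^ (k + 1) → dist y y' = 0 := by
    intro y y' h hd
    have h1 : D y y' ≤ q ^ (k + 1) := by
      have := (hDd y y').trans hd
      exact_mod_cast this
    have h2 : D y y' = 0 := (hDzero _ _).2 fun n =>
      hanti _ _ _ (hsucc y y' (hDle.1 h1) n (h ▸ hrefl n _))
    refine le_antisymm ?_ dist_nonneg
    have := hdD y y'
    rwa [h2] at this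
  -- The factor `q` makes chains of length up to `ε / q` liftable. The `4` lets `hinj` apply to two
  -- points within `ε` of a third: they are `2 * ε` apart, and `D ≤ 2 * dist` doubles this.
  set ε : ℝ := q ^ (k + 1) * q / 4 with hε
  have hεpos : 0 < ε := by positivity
  have hq1R : (q : ℝ) < 1 := by exact_mod_cast hq1
  have hpow : (0 : ℝ) < q ^ (k + 1) := by positivity
  have hε4 : 4 * ε ≤ (q : ℝ) ^ (k + 1) := by
    rw [hε]; nlinarith
  have hεq : ∀ {t : ℝ}, q * t ≤ ε → t ≤ (q : ℝ) ^ (k + 1) := by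
    intro t ht
    have h1 : (q : ℝ) * t ≤ q * q ^ (k + 1) := by rw [hε] at ht; nlinarith
    exact le_of_mul_le_mul_left h1 hqR
  refine ⟨dist, ε, (q : ℝ)⁻¹, dist_self, dist_comm, dist_triangle, ?_, ?_, hεpos,
    (one_lt_inv₀ hqR).2 hq1R, ?_, ?_⟩
  · intro x y
    rw [← hDzero]
    constructor
    · intro h
      have := hDd x y
      rw [h, mul_zero] at this
      exact_mod_cast le_antisymm this (NNReal.coe_nonneg _)
    · intro h
      have := hdD x y
      rw [h] at this
      exact le_antisymm this dist_nonneg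
  · intro δ hδ
    obtain ⟨n, hn⟩ := exists_pow_lt_of_lt_one hδ hq1R
    refine ⟨n, fun x y h => (hdD x y).trans_lt (lt_of_le_of_lt ?_ hn)⟩
    exact_mod_cast hDle.2 h
  · intro x y hxy
    rw [eq_inv_mul_iff_mul_eq₀ hqR.ne']
    refine le_antisymm (hdσ x y) ?_
    by_contra! hlt
    -- A chain from `σ x` to `σ y` that is too short would lift to a chain from `x` to some `y'`
    -- with `σ y' = σ y`. Then `y'` is at distance `0` from `y`, so `x` and `y` would be closer than
    -- they are.
    obtain ⟨t, ht1, ht2⟩ := exists_between hlt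
    have ht1' : dist (σ x) (σ y) < t / q := by rwa [lt_div_iff₀' hqR]
    obtain ⟨s, hs, hch⟩ := hdchain ht1'
    have hst : (q : ℝ) * s < t := by rwa [lt_div_iff₀' hqR] at hs
    have hs' : s ≤ q ^ (k + 1) := by
      have := hεq (hst.trans (ht2.trans hxy)).le
      exact_mod_cast this
    obtain ⟨y', hy', hd⟩ := hchlift hch hs' x rfl
    have h1 : dist y y' = 0 := by
      refine hinj y y' hy'.symm ?_
      have := dist_triangle_left y y' x
      linarith
    have := dist_triangle x y' y
    rw [dist_comm y' y, h1] at this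
    linarith
  · intro x w α hα h
    obtain ⟨s, hs, hch⟩ := hdchain h
    have hst : (q : ℝ) * s < α := by rwa [lt_inv_mul_iff₀ hqR] at hs
    have hs' : s ≤ q ^ (k + 1) := by
      have := hεq (hst.le.trans hα)
      exact_mod_cast this
    obtain ⟨y, hy, hd⟩ := hchlift hch hs' x rfl
    exact ⟨y, hy, hd.trans_lt hst⟩

end ScaleDist

/-! ### Compatible metrics on compact spaces -/

theorem isCompatibleMetric_of_compactSpace {X : Type*} [TopologicalSpace X] [CompactSpace X]
    {d : X → X → ℝ} (hself : ∀ x, d x x = 0) (heq : ∀ x y, d x y = 0 → x = y)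
    (hcomm : ∀ x y, d x y = d y x) (htri : ∀ x y z, d x z ≤ d x y + d y z)
    (hopen : ∀ x δ, IsOpen {y | d x y < δ}) : IsCompatibleMetric d := by
  have hnn : ∀ x y, 0 ≤ d x y := by
    intro x y
    have := htri x y x
    rw [hself, hcomm y x] at this
    linarith
  have hcont : ∀ x, Continuous (d x) := by
    intro x
    rw [continuous_iff_continuousAt]
    intro y
    rw [ContinuousAt, Metric.tendsto_nhds]
    intro δ hδ
    filter_upwards [(hopen y δ).mem_nhds (by simpa [hself] using hδ)] with z hz
    have h1 := htri x y z
    have h2 := htri x z y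
    rw [hcomm z y] at h2
    rw [Real.dist_eq, abs_lt]
    have hz : d y z < δ := hz
    constructor <;> linarith
  refine ⟨hself, heq, hcomm, htri, fun s => ⟨fun hs x hx => ?_, fun h => ?_⟩⟩
  -- The distance from `x` attains a minimum on the compact complement, positive since `x` is not in
  -- it; this minimum is the required radius.
  · have hc : IsCompact sᶜ := hs.isClosed_compl.isCompact
    rcases sᶜ.eq_empty_or_nonempty with he | hne
    · exact ⟨1, one_pos, fun y _ => by rw [Set.compl_empty_iff.1 he]; trivial⟩
    obtain ⟨y, hy, hmin⟩ := hc.exists_isMinOn hne (hcont x).continuousOn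
    refine ⟨d x y, (hnn x y).lt_of_ne fun h0 => ?_, fun z hz => ?_⟩
    · exact hy (heq x y h0.symm ▸ hx)
    · by_contra hzs
      exact absurd (hmin hzs) (not_le.2 hz)
  · rw [isOpen_iff_mem_nhds]
    intro x hx
    obtain ⟨δ, hδ, hs⟩ := h x hx
    exact mem_of_superset ((hopen x δ).mem_nhds (by simpa [hself] using hδ)) hs

/-- The metric space structure given by a compatible metric. -/
@[reducible]
noncomputable def IsCompatibleMetric.toMetricSpace {X : Type*} [TopologicalSpace X] {d : X → X → ℝ}
    (h : IsCompatibleMetric d) : MetricSpace X :=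
  MetricSpace.ofDistTopology d h.self h.comm h.triangle h.isOpen_iff h.eq_of_zero

/-! ### Topology of the path spaces -/

namespace DirectedGraph

variable {V : Type u} {Edge : Type v} {E : DirectedGraph V Edge}

theorem LeftPath.eventually_edge_eq (x : E.LeftPath) (S : Finset ℕ) :
    ∀ᶠ y : E.LeftPath in 𝓝 x, ∀ i ∈ S, y.edge i = x.edge i := by
  let _ : TopologicalSpace Edge := ⊥
  have : DiscreteTopology Edge := ⟨rfl⟩
  rw [S.eventually_all]
  intro i _
  have hc : Continuous fun y : E.LeftPath => y.edge i :=
    (continuous_apply i).comp continuous_induced_dom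
  exact hc.continuousAt.preimage_mem_nhds (t := {x.edge i}) (by simp)

theorem LeftPath.eventually_final_eq (x : E.LeftPath) (n : ℕ) :
    ∀ᶠ y : E.LeftPath in 𝓝 x, y.final n = x.final n := by
  filter_upwards [x.eventually_edge_eq (Finset.range n)] with y hy
  exact List.map_congr_left fun i hi => hy i (by simpa using hi)

theorem BiPath.exists_of_isOpen {U : Set E.BiPath} (hU : IsOpen U) {x : E.BiPath} (hx : x ∈ U) :
    ∃ k : ℕ, ∀ y : E.BiPath, (∀ i : ℤ, -k ≤ i → i ≤ k → y.edge i = x.edge i) → y ∈ U := by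
  let _ : TopologicalSpace Edge := ⊥
  obtain ⟨W, hW, rfl⟩ := isOpen_induced_iff.1 hU
  obtain ⟨I, u, hu, hI⟩ := isOpen_pi_iff.1 hW _ hx
  obtain ⟨k, hk⟩ : ∃ k : ℕ, ∀ i ∈ I, i.natAbs ≤ k :=
    ⟨I.sup Int.natAbs, fun i hi => Finset.le_sup (f := Int.natAbs) hi⟩
  refine ⟨k, fun y hy => hI fun i hi => ?_⟩
  have := hk i hi
  have e : y.edge i = x.edge i := hy i (by omega) (by omega)
  show y.edge i ∈ u i
  rw [e]
  exact (hu i hi).2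

instance [Finite Edge] : CompactSpace E.LeftPath := by
  let _ : TopologicalSpace Edge := ⊥
  have : DiscreteTopology Edge := ⟨rfl⟩
  have hi : IsInducing (fun x : E.LeftPath => x.edge) := ⟨rfl⟩
  have hr : Set.range (fun x : E.LeftPath => x.edge) =
      ⋂ k, {z : ℕ → Edge | E.s (z (k + 1)) = E.r (z k)} := by
    ext z
    simp only [Set.mem_range, Set.mem_iInter]
    exact ⟨fun ⟨x, hx⟩ k => hx ▸ x.chain k, fun h => ⟨⟨z, h⟩, rfl⟩⟩
  have hc : IsClosed (Set.range (fun x : E.LeftPath => x.edge)) := by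
    rw [hr]
    refine isClosed_iInter fun k => ?_
    have : Continuous fun z : ℕ → Edge => (z (k + 1), z k) := by fun_prop
    exact (isClosed_discrete {p : Edge × Edge | E.s p.1 = E.r p.2}).preimage this
  refine ⟨hi.isCompact_iff.2 ?_⟩
  rw [Set.image_univ]
  exact hc.isCompact

instance [Finite Edge] : CompactSpace E.BiPath := by
  let _ : TopologicalSpace Edge := ⊥
  have : DiscreteTopology Edge := ⟨rfl⟩
  have hi : IsInducing (fun x : E.BiPath => x.edge) := ⟨rfl⟩
  have hr : Set.range (fun x : E.BiPath => x.edge) =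
      ⋂ k, {z : ℤ → Edge | E.s (z k) = E.r (z (k + 1))} := by
    ext z
    simp only [Set.mem_range, Set.mem_iInter]
    exact ⟨fun ⟨x, hx⟩ k => hx ▸ x.chain k, fun h => ⟨⟨z, h⟩, rfl⟩⟩
  have hc : IsClosed (Set.range (fun x : E.BiPath => x.edge)) := by
    rw [hr]
    refine isClosed_iInter fun k => ?_
    have : Continuous fun z : ℤ → Edge => (z k, z (k + 1)) := by fun_prop
    exact (isClosed_discrete {p : Edge × Edge | E.s p.1 = E.r p.2}).preimage this
  refine ⟨hi.isCompact_iff.2 ?_⟩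
  rw [Set.image_univ]
  exact hc.isCompact

theorem BiPath.continuous_leftPart (n : ℤ) : Continuous fun x : E.BiPath => x.leftPart n := by
  let _ : TopologicalSpace Edge := ⊥
  refine continuous_induced_rng.2 (continuous_pi fun k => ?_)
  exact (continuous_apply (n - (k : ℤ))).comp continuous_induced_dom

end DirectedGraph

/-! ### The expanding metric on the limit space -/

namespace SelfSimilarAction

variable {V : Type u} {Edge : Type v} {E : DirectedGraph V Edge} [Groupoid.{w} V]
  (A : SelfSimilarAction E) [Finite V]

instance [Finite Edge] : CompactSpace A.LimitSpace :=
  inferInstanceAs (CompactSpace (Quotient A.leftSetoid))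

instance [Finite Edge] : CompactSpace A.Solenoid :=
  inferInstanceAs (CompactSpace (Quotient A.biSetoid))

theorem isQuotientMap_toLimitSpace : IsQuotientMap A.toLimitSpace := isQuotientMap_quot_mk

theorem isQuotientMap_toSolenoid : IsQuotientMap A.toSolenoid := isQuotientMap_quot_mk

theorem toLimitSpace_eq_iff {x y : E.LeftPath} :
    A.toLimitSpace x = A.toLimitSpace y ↔ A.LeftAsymp x y := Quotient.eq (r := A.leftSetoid)

theorem toSolenoid_eq_iff {x y : E.BiPath} :
    A.toSolenoid x = A.toSolenoid y ↔ A.BiAsymp x y := Quotient.eq (r := A.biSetoid)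

theorem shiftLimit_toLimitSpace (x : E.LeftPath) :
    A.shiftLimit (A.toLimitSpace x) = A.toLimitSpace x.shift := rfl

variable {A}

/-- The pseudometric on left-infinite paths vanishes exactly on asymptotic pairs, so it descends to
a metric. Its balls are open because paths with the same last `n` edges are related at level `n`,
hence close; compactness does the rest. -/
theorem exists_isExpandingMetric [Finite Edge] (hs : E.NoSources) (hc : A.IsContracting)
    (hr : A.IsRegular) : ∃ d ε c, A.IsExpandingMetric d ε c := by
  obtain ⟨N, hN⟩ := exists_nucleus hs hc
  obtain ⟨m, hm⟩ := hN.exists_nucRel_trans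
  obtain ⟨k, hk⟩ := hN.exists_nucRel_succ hs hr
  obtain ⟨d, ε, c, h0, hcomm, htri, hzero, hsmall, hε, hc1, hexp, hball⟩ :=
    exists_expanding_pseudometric (R := A.NucRel N) LeftPath.shift hN.nucRel_zero
      (fun n x y h => hN.nucRel_anti n.le_succ h) (fun n x => hN.nucRel_of_final_eq rfl)
      (fun n x y h => hN.nucRel_symm h) hm (fun n x y h => h.shift) hk
      (fun n x u h => h.exists_lift)
  have hnn : ∀ x y, 0 ≤ d x y := by
    intro x y
    have := htri x y x
    rw [h0, hcomm y x] at this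
    linarith
  have hle : ∀ x x' y y', A.LeftAsymp x x' → A.LeftAsymp y y' → d x y ≤ d x' y' := by
    intro x x' y y' hx hy
    have h1 := (hzero x x').2 (hN.leftAsymp_iff.1 hx)
    have h2 := (hzero y y').2 (hN.leftAsymp_iff.1 hy)
    have h3 := htri x x' y
    have h4 := htri x' y' y
    rw [hcomm y' y] at h4
    linarith
  have hwell : ∀ x y x' y', A.leftSetoid x x' → A.leftSetoid y y' → d x y = d x' y' :=
    fun x y x' y' hx hy => le_antisymm (hle _ _ _ _ hx hy)
      (hle _ _ _ _ (A.leftSetoid.symm hx) (A.leftSetoid.symm hy))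
  let D : A.LimitSpace → A.LimitSpace → ℝ := fun z z' =>
    Quotient.liftOn₂' (s₁ := A.leftSetoid) (s₂ := A.leftSetoid) z z' d hwell
  have hD : ∀ x y, D (A.toLimitSpace x) (A.toLimitSpace y) = d x y := fun _ _ => rfl
  have hsurj := A.isQuotientMap_toLimitSpace.surjective
  refine ⟨D, ε, c, isCompatibleMetric_of_compactSpace ?_ ?_ ?_ ?_ ?_, hε, hc1, ?_, ?_⟩
  · exact hsurj.forall.2 h0
  · refine hsurj.forall₂.2 fun x y h => ?_
    rw [toLimitSpace_eq_iff, hN.leftAsymp_iff]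
    exact (hzero x y).1 h
  · exact hsurj.forall₂.2 hcomm
  · exact hsurj.forall₃.2 htri
  · refine hsurj.forall.2 fun x δ => A.isQuotientMap_toLimitSpace.isOpen_preimage.1 ?_
    rw [isOpen_iff_mem_nhds]
    intro y (hy : d x y < δ)
    obtain ⟨n, hn⟩ := hsmall (δ - d x y) (by linarith)
    filter_upwards [y.eventually_final_eq n] with z hz
    have h1 := hn y z (hN.nucRel_of_final_eq hz.symm)
    have h2 := htri x y z
    show d x z < δ
    linarith
  · exact hsurj.forall₂.2 hexp
  · refine hsurj.forall.2 fun x α hα => Set.Subset.antisymm ?_ ?_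
    · rintro _ ⟨z, hz, rfl⟩
      obtain ⟨y, rfl⟩ := hsurj z
      have hz : d x y < α := hz
      show d x.shift y.shift < c * α
      rw [hexp x y (hz.trans_le hα)]
      exact mul_lt_mul_of_pos_left hz (by linarith)
    · intro z hz
      obtain ⟨w, rfl⟩ := hsurj z
      obtain ⟨y, rfl, hy⟩ := hball x w α hα hz
      exact ⟨A.toLimitSpace y, hy, rfl⟩

end SelfSimilarAction

/-! ### Smale spaces from inverse limits of locally scaling maps -/

theorem continuous_of_isClosed_graph_of_compactSpace {X Y : Type*} [TopologicalSpace X]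
    [TopologicalSpace Y] [CompactSpace Y] {g : X → Y} (h : IsClosed {p : X × Y | p.2 = g p.1}) :
    Continuous g := by
  rw [continuous_iff_isClosed]
  intro C hC
  have e : g ⁻¹' C = Prod.fst '' ({p : X × Y | p.2 = g p.1} ∩ Prod.snd ⁻¹' C) := by
    ext x
    constructor
    · exact fun hx => ⟨(x, g x), ⟨rfl, hx⟩, rfl⟩
    · rintro ⟨⟨x, y⟩, ⟨h1, hy⟩, rfl⟩
      have h1 : y = g x := h1
      exact h1 ▸ hy
  rw [e]
  exact isClosedMap_fst_of_compactSpace _ (h.inter (hC.preimage continuous_snd))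

/-- Around `a`, the ball of radius `ε` and the exterior of radius `ε / 2` cover `T`, and within `T`
they cannot meet. -/
theorem IsPreconnected.subsingleton_of_dist {X : Type*} [MetricSpace X] {T : Set X}
    (hT : IsPreconnected T) {ε : ℝ} (hε : 0 < ε)
    (h : ∀ a ∈ T, ∀ b ∈ T, dist a b < ε → a = b) : T.Subsingleton := by
  intro a ha b hb
  by_contra hab
  have hε2 : ε / 2 < ε := half_lt_self hε
  obtain ⟨x, hx, h1, h2⟩ := hT (Metric.ball a ε) {x | ε / 2 < dist x a} Metric.isOpen_ball
    (isOpen_lt continuous_const (continuous_id.dist continuous_const))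
    (fun x _ => by
      by_cases hx : dist x a < ε
      · exact Or.inl hx
      · exact Or.inr (hε2.trans_le (not_lt.1 hx)))
    ⟨a, ha, Metric.mem_ball_self hε⟩
    ⟨b, hb, by
      by_contra hba
      exact hab (h b hb a ha ((not_lt.1 hba).trans_lt hε2)).symm⟩
  have h2 : ε / 2 < dist x a := h2
  rw [h x hx a ha h1, dist_self] at h2
  linarith

/-- `f` multiplies distances smaller than `ε` by `c > 1`, and maps the ball of radius `α ≤ ε` around
`z` onto the ball of radius `c α` around `f z`. -/
structure IsLocallyScaling {J : Type*} [MetricSpace J] (f : J → J) (ε c : ℝ) : Prop where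
  ε_pos : 0 < ε
  one_lt : 1 < c
  expand : ∀ z z', dist z z' < ε → dist (f z) (f z') = c * dist z z'
  image_ball : ∀ z α, α ≤ ε → f '' {z' | dist z z' < α} = {z' | dist (f z) z' < c * α}

/-- `S` with the projections `π m` is the inverse limit of `… → J → J → J`, all maps being `f`, and
`φ` is the homeomorphism of `S` induced by `f`. -/
structure IsInverseLimit {J S : Type*} [TopologicalSpace J] [TopologicalSpace S] (f : J → J)
    (π : ℕ → S → J) (φ : S ≃ₜ S) : Prop where
  continuous : ∀ m, Continuous (π m)
  map_succ : ∀ m s, f (π (m + 1) s) = π m s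
  ext : ∀ s t, (∀ m, π m s = π m t) → s = t
  exists_of : ∀ z : ℕ → J, (∀ m, f (z (m + 1)) = z m) → ∃ s, ∀ m, π m s = z m
  zero_apply : ∀ s, π 0 (φ s) = f (π 0 s)
  succ_apply : ∀ m s, π (m + 1) (φ s) = π m s

section InverseLimit

variable {J S : Type*} [MetricSpace J] {f : J → J} {ε c : ℝ} {π : ℕ → S → J} {dS : S → S → ℝ}

variable (π c) in
/-- The metric `sup_m (1/c)^m d(π m s, π m t)` on an inverse limit. -/
noncomputable def supDist (s t : S) : ℝ := ⨆ m : ℕ, (1 / c) ^ m * dist (π m s) (π m t)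

theorem isLUB_supDist [CompactSpace J] (hc : 1 < c) (s t : S) :
    IsLUB (Set.range fun m : ℕ => (1 / c) ^ m * dist (π m s) (π m t)) (supDist c π s t) := by
  refine isLUB_ciSup ⟨Metric.diam (Set.univ : Set J), ?_⟩
  rintro _ ⟨m, rfl⟩
  have h1 : (1 / c) ^ m ≤ 1 :=
    pow_le_one₀ (by positivity) ((div_le_one (by positivity)).2 hc.le)
  have h2 : dist (π m s) (π m t) ≤ Metric.diam (Set.univ : Set J) :=
    Metric.dist_le_diam_of_mem isCompact_univ.isBounded trivial trivial
  exact (mul_le_of_le_one_left dist_nonneg h1).trans h2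

theorem dist_zero_le
    (hd : ∀ s t, IsLUB (Set.range fun m : ℕ => (1 / c) ^ m * dist (π m s) (π m t)) (dS s t))
    (s t : S) : dist (π 0 s) (π 0 t) ≤ dS s t := by
  simpa using (hd s t).1 ⟨0, rfl⟩

variable [TopologicalSpace S] {φ : S ≃ₜ S}

theorem isCompatibleMetric_supDist [CompactSpace J] [CompactSpace S] (hc : 1 < c)
    (hπ : ∀ m, Continuous (π m)) (hext : ∀ s t, (∀ m, π m s = π m t) → s = t) :
    IsCompatibleMetric (supDist c π) := by
  have hc0 : 0 < 1 / c := by positivity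
  have hc1 : 1 / c < 1 := (div_lt_one (by positivity)).2 hc
  have hlub := isLUB_supDist (π := π) hc
  have hle : ∀ s t m, (1 / c) ^ m * dist (π m s) (π m t) ≤ supDist c π s t :=
    fun s t m => (hlub s t).1 ⟨m, rfl⟩
  have hsup : ∀ s t b, (∀ m, (1 / c) ^ m * dist (π m s) (π m t) ≤ b) → supDist c π s t ≤ b :=
    fun s t b h => (hlub s t).2 (by rintro _ ⟨m, rfl⟩; exact h m)
  have hself : ∀ s, supDist c π s s = 0 := fun s => by simp [supDist]
  have htri : ∀ s t r, supDist c π s r ≤ supDist c π s t + supDist c π t r := by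
    intro s t r
    refine hsup _ _ _ fun m => ?_
    calc (1 / c) ^ m * dist (π m s) (π m r)
        ≤ (1 / c) ^ m * (dist (π m s) (π m t) + dist (π m t) (π m r)) := by
          gcongr; exact dist_triangle _ _ _
      _ ≤ _ := by rw [mul_add]; exact add_le_add (hle _ _ _) (hle _ _ _)
  refine isCompatibleMetric_of_compactSpace hself ?_ ?_ htri ?_
  · refine fun s t h => hext s t fun m => ?_
    have h1 := hle s t m
    rw [h] at h1
    have h2 : dist (π m s) (π m t) ≤ 0 := nonpos_of_mul_nonpos_right h1 (by positivity)
    exact dist_le_zero.1 h2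
  · intro s t
    simp only [supDist, dist_comm]
  · intro s δ
    rw [isOpen_iff_mem_nhds]
    intro t (ht : supDist c π s t < δ)
    set r := (δ - supDist c π s t) / 2 with hr
    have hr0 : 0 < r := by rw [hr]; linarith
    -- The weights make all coordinates from `M` on negligible, so only finitely many continuity
    -- conditions remain.
    obtain ⟨M, hM⟩ : ∃ M : ℕ, (1 / c) ^ M * Metric.diam (Set.univ : Set J) < r := by
      have := (tendsto_pow_atTop_nhds_zero_of_lt_one hc0.le hc1).mul_const
        (Metric.diam (Set.univ : Set J))
      rw [zero_mul] at this
      exact (this.eventually (gt_mem_nhds hr0)).exists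
    have hev : ∀ᶠ t' in 𝓝 t, ∀ m ∈ Finset.range M, dist (π m t) (π m t') < r := by
      rw [Finset.eventually_all]
      intro m _
      have hcont : Continuous fun t' => dist (π m t) (π m t') := continuous_const.dist (hπ m)
      exact hcont.continuousAt.eventually (gt_mem_nhds (by simpa using hr0))
    filter_upwards [hev] with t' ht'
    have h1 : supDist c π t t' ≤ r := by
      refine hsup _ _ _ fun m => ?_
      rcases lt_or_ge m M with hm | hm
      · have h2 := (ht' m (Finset.mem_range.2 hm)).le
        have h3 : (1 / c) ^ m ≤ 1 := pow_le_one₀ hc0.le hc1.le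
        exact (mul_le_of_le_one_left dist_nonneg h3).trans h2
      · refine le_trans ?_ hM.le
        gcongr ?_ * ?_
        · exact pow_le_pow_of_le_one hc0.le hc1.le hm
        · exact Metric.dist_le_diam_of_mem isCompact_univ.isBounded trivial trivial
    have h2 := htri s t t'
    show supDist c π s t' < δ
    linarith

theorem IsLocallyScaling.exists_preimage (hf : IsLocallyScaling f ε c) {u v' : J}
    (h : dist u (f v') < c * (ε / 2)) : ∃ u', f u' = u ∧ dist u' v' < ε / 2 := by
  have h1 : u ∈ {z | dist (f v') z < c * (ε / 2)} := by
    show dist (f v') u < _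
    rwa [dist_comm]
  rw [← hf.image_ball v' (ε / 2) (by linarith [hf.ε_pos])] at h1
  obtain ⟨u', h2, h3⟩ := h1
  exact ⟨u', h3, by rw [dist_comm]; exact h2⟩

theorem IsLocallyScaling.eq_of_map_eq (hf : IsLocallyScaling f ε c) {u u' : J}
    (h : dist u u' < ε) (he : f u = f u') : u = u' := by
  have h1 := hf.expand u u' h
  rw [he, dist_self] at h1
  have hc := hf.one_lt
  exact dist_eq_zero.1 ((mul_eq_zero.1 h1.symm).resolve_left (by linarith))

variable (π ε) in
/-- `w` has the same image as `s` under `π 0` and is, at all levels, close to `t`. -/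
def IsBracket (s t w : S) : Prop := π 0 w = π 0 s ∧ ∀ m, dist (π m w) (π m t) < ε / 2

/-- The coordinates are built by successive lifting: the ball of radius `ε / 2` around `π (m + 1) t`
covers the ball of the larger radius `c * (ε / 2)` around `π m t`. -/
theorem exists_isBracket (hf : IsLocallyScaling f ε c) (hS : IsInverseLimit f π φ) {s t : S}
    (h : dist (π 0 s) (π 0 t) < ε / 2) : ∃ w, IsBracket ε π s t w := by
  have hstep : ∀ (m : ℕ) (u : {u : J // dist u (π m t) < ε / 2}),
      ∃ u' : {u : J // dist u (π (m + 1) t) < ε / 2}, f u'.1 = u.1 := by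
    rintro m ⟨u, hu⟩
    rw [← hS.map_succ] at hu
    have : ε / 2 < c * (ε / 2) := lt_mul_of_one_lt_left (by linarith [hf.ε_pos]) hf.one_lt
    obtain ⟨u', h1, h2⟩ := hf.exists_preimage (hu.trans this)
    exact ⟨⟨u', h2⟩, h1⟩
  choose F hF using hstep
  let z : ∀ m : ℕ, {u : J // dist u (π m t) < ε / 2} := fun m => Nat.rec ⟨_, h⟩ F m
  obtain ⟨w, hw⟩ := hS.exists_of (fun m => (z m).1) fun m => hF m (z m)
  exact ⟨w, hw 0, fun m => by rw [hw m]; exact (z m).2⟩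

theorem IsBracket.dist_eq (hf : IsLocallyScaling f ε c) (hS : IsInverseLimit f π φ) {s t w : S}
    (h : IsBracket ε π s t w) (m : ℕ) :
    dist (π m w) (π m t) = (1 / c) ^ m * dist (π 0 s) (π 0 t) := by
  have hc := hf.one_lt
  have hc0 : c ≠ 0 := by positivity
  induction m with
  | zero => rw [h.1, pow_zero, one_mul]
  | succ m ih =>
    have h1 := hf.expand _ _ ((h.2 (m + 1)).trans (half_lt_self hf.ε_pos))
    rw [hS.map_succ, hS.map_succ, ih] at h1
    rw [pow_succ, mul_right_comm, h1]
    field_simp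

/-- At each level the two candidates are less than `ε` apart, where `f` is injective. -/
theorem IsBracket.unique (hf : IsLocallyScaling f ε c) (hS : IsInverseLimit f π φ)
    {s t w w' : S} (h : IsBracket ε π s t w) (h' : IsBracket ε π s t w') : w = w' := by
  refine hS.ext _ _ fun m => ?_
  induction m with
  | zero => rw [h.1, h'.1]
  | succ m ih =>
    refine hf.eq_of_map_eq ?_ (by rw [hS.map_succ, hS.map_succ, ih])
    have := dist_triangle_right (π (m + 1) w) (π (m + 1) w') (π (m + 1) t)
    have h1 := h.2 (m + 1)
    have h2 := h'.2 (m + 1)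
    linarith

open Classical in
variable (π ε) in
/-- The bracket `[s, t]` of an inverse limit. -/
noncomputable def bracket (s t : S) : S :=
  if h : ∃ w, IsBracket ε π s t w then h.choose else s

theorem isBracket_bracket (hf : IsLocallyScaling f ε c) (hS : IsInverseLimit f π φ) {s t : S}
    (h : dist (π 0 s) (π 0 t) < ε / 2) : IsBracket ε π s t (bracket ε π s t) := by
  have h1 := exists_isBracket hf hS h
  rw [bracket, dif_pos h1]
  exact h1.choose_spec

theorem IsBracket.bracket_eq (hf : IsLocallyScaling f ε c) (hS : IsInverseLimit f π φ)
    {s t w : S} (h : IsBracket ε π s t w) : bracket ε π s t = w := by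
  have h1 : ∃ w, IsBracket ε π s t w := ⟨w, h⟩
  rw [bracket, dif_pos h1]
  exact h1.choose_spec.unique hf hS h

theorem isSmaleSpace_of_isInverseLimit [CompactSpace S] (hf : IsLocallyScaling f ε c)
    (hS : IsInverseLimit f π φ) (hdS : IsCompatibleMetric dS)
    (hd : ∀ s t, IsLUB (Set.range fun m : ℕ => (1 / c) ^ m * dist (π m s) (π m t)) (dS s t)) :
    IsSmaleSpace dS φ (ε / 8) (1 / c) (bracket ε π) := by
  have hε := hf.ε_pos
  have hc := hf.one_lt
  have hc0 : 0 < 1 / c := by positivity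
  have hc1 : 1 / c < 1 := (div_lt_one (by positivity)).2 hc
  have h0 := dist_zero_le hd
  have hbr : ∀ {s t : S}, dS s t ≤ ε / 8 → IsBracket ε π s t (bracket ε π s t) := fun {s t} h =>
    isBracket_bracket hf hS (by linarith [h0 s t])
  have hle : ∀ {s t w : S}, IsBracket ε π s t w → ∀ m, dist (π m w) (π m t) ≤ dS s t := by
    intro s t w h m
    rw [h.dist_eq hf hS m]
    exact (mul_le_of_le_one_left dist_nonneg (pow_le_one₀ hc0.le hc1.le)).trans (h0 s t)
  refine ⟨inferInstance, hdS, by positivity, hc0, hc1, ?_, ?_, ?_, ?_, ?_, ?_, ?_⟩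
  · rw [continuousOn_iff_continuous_domRestrict]
    refine continuous_of_isClosed_graph_of_compactSpace ?_
    -- On the domain of the bracket the strict bound `ε / 2` may be replaced by the closed bound `ε
    -- / 8`, so the graph is closed. The same small constant lets two such bounds add up below `ε /
    -- 2` in the associativity axiom.
    have e : {p : {p : S × S | dS p.1 p.2 ≤ ε / 8} × S |
        p.2 = Set.domRestrict {p : S × S | dS p.1 p.2 ≤ ε / 8}
          (fun p : S × S => bracket ε π p.1 p.2) p.1} =
        {p | π 0 p.2 = π 0 p.1.1.1} ∩ ⋂ m, {p | dist (π m p.2) (π m p.1.1.2) ≤ ε / 8} := by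
      ext ⟨⟨⟨s, t⟩, hst⟩, w⟩
      have hst : dS s t ≤ ε / 8 := hst
      simp only [Set.mem_ofPred_eq, Set.domRestrict_apply, Set.mem_inter_iff, Set.mem_iInter]
      constructor
      · rintro rfl
        exact ⟨(hbr hst).1, fun m => (hle (hbr hst) m).trans hst⟩
      · rintro ⟨h1, h2⟩
        exact (IsBracket.bracket_eq hf hS ⟨h1, fun m => (h2 m).trans_lt (by linarith)⟩).symm
    rw [e]
    have hπ := hS.continuous
    refine (isClosed_eq ?_ ?_).inter (isClosed_iInter fun m => isClosed_le (Continuous.dist ?_ ?_)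
      continuous_const)
    · exact (hπ 0).comp continuous_snd
    · exact (hπ 0).comp (continuous_fst.comp (continuous_subtype_val.comp continuous_fst))
    · exact (hπ m).comp continuous_snd
    · exact (hπ m).comp (continuous_snd.comp (continuous_subtype_val.comp continuous_fst))
  · exact fun s => IsBracket.bracket_eq hf hS ⟨rfl, fun m => by simpa using by positivity⟩
  · intro x y z hyz hx hxz
    have h1 := hbr hyz
    have h2 := hbr hx
    refine (IsBracket.bracket_eq hf hS ⟨h2.1, fun m => ?_⟩).symm
    have := dist_triangle (π m (bracket ε π x (bracket ε π y z))) (π m (bracket ε π y z)) (π m z)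
    have h3 := hle h1 m
    have h4 := hle h2 m
    linarith
  · intro x y z hxy hz hxz
    have h1 := hbr hxy
    have h2 := hbr hz
    exact (IsBracket.bracket_eq hf hS ⟨h2.1.trans h1.1, h2.2⟩).symm
  · intro x y hxy hφ
    have h1 := hbr hxy
    have h2 := h0 (φ x) (φ y)
    have h3 : π 0 (φ (bracket ε π x y)) = π 0 (φ x) := by
      rw [hS.zero_apply, hS.zero_apply, h1.1]
    refine (IsBracket.bracket_eq hf hS ⟨h3, fun m => ?_⟩).symm
    cases m with
    | zero => rw [h3]; linarith
    | succ m => rw [hS.succ_apply, hS.succ_apply]; exact h1.2 m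
  · intro x y hxy h
    have h1 := hbr hxy
    rw [h] at h1
    -- `[x, y] = y` means equal zeroth coordinates. Since `φ` moves every coordinate one level up,
    -- the new zeroth term vanishes and the others gain a factor `1 / c`.
    refine (hd _ _).2 ?_
    rintro _ ⟨m, rfl⟩
    cases m with
    | zero =>
      have : 0 ≤ dS x y := dist_nonneg.trans (h0 x y)
      simp only [hS.zero_apply, h1.1, dist_self, mul_zero]
      positivity
    | succ m =>
      simp only [hS.succ_apply, pow_succ', mul_assoc]
      gcongr
      exact (hd x y).1 ⟨m, rfl⟩
  · intro x y hxy h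
    have h1 := hbr hxy
    rw [h] at h1
    have hsymm : ∀ m s, π m (φ.symm s) = π (m + 1) s := fun m s => by
      rw [← hS.succ_apply m (φ.symm s), φ.apply_symm_apply]
    refine (hd _ _).2 ?_
    rintro _ ⟨m, rfl⟩
    simp only [hsymm]
    -- `[x, y] = x` means that coordinate distances decay exactly like `(1 / c) ^ m`, and `φ.symm`
    -- drops the zeroth coordinate.
    rw [h1.dist_eq hf hS (m + 1), pow_succ']
    have h3 := h0 x y
    have h4 : (1 / c) ^ m ≤ 1 := pow_le_one₀ hc0.le hc1.le
    calc (1 / c) ^ m * (1 / c * (1 / c) ^ m * dist (π 0 x) (π 0 y))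
        ≤ 1 * (1 / c * 1 * dS x y) := by gcongr
      _ = 1 / c * dS x y := by ring

/-- Once level `m` is constant on `T`, level `m + 1` takes values in one fibre of `f`. Distinct
points of a fibre are at least `ε` apart, so the connected image is a point. -/
theorem IsPreconnected.subsingleton_of_fiber (hf : IsLocallyScaling f ε c)
    (hS : IsInverseLimit f π φ) {T : Set S} (hT : IsPreconnected T)
    (h : ∀ s ∈ T, ∀ t ∈ T, π 0 s = π 0 t) : T.Subsingleton := by
  suffices H : ∀ m, ∀ s ∈ T, ∀ t ∈ T, π m s = π m t from
    fun s hs t ht => hS.ext s t fun m => H m s hs t ht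
  intro m
  induction m with
  | zero => exact h
  | succ m ih =>
    have h1 : (π (m + 1) '' T).Subsingleton := by
      refine (hT.image _ (hS.continuous _).continuousOn).subsingleton_of_dist hf.ε_pos ?_
      rintro _ ⟨s, hs, rfl⟩ _ ⟨t, ht, rfl⟩ hst
      exact hf.eq_of_map_eq hst (by rw [hS.map_succ, hS.map_succ, ih s hs t ht])
    exact fun s hs t ht => h1 ⟨s, hs, rfl⟩ ⟨t, ht, rfl⟩

theorem hasTotallyDisconnectedStableSets_of_isInverseLimit (hf : IsLocallyScaling f ε c)
    (hS : IsInverseLimit f π φ) (hdS : IsCompatibleMetric dS)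
    (hd : ∀ s t, IsLUB (Set.range fun m : ℕ => (1 / c) ^ m * dist (π m s) (π m t)) (dS s t)) :
    HasTotallyDisconnectedStableSets dS φ (ε / 8) (bracket ε π) := by
  have hε := hf.ε_pos
  have hfib : ∀ {x y : S} {δ : ℝ}, δ ≤ ε / 8 → y ∈ localStableSet dS (bracket ε π) x δ →
      π 0 y = π 0 x := by
    rintro x y δ hδ ⟨h1, h2⟩
    have h3 : dist (π 0 y) (π 0 x) < ε / 2 := by
      have := dist_zero_le hd x y
      rw [dist_comm] at this
      linarith
    have h4 := (isBracket_bracket hf hS h3).1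
    rw [h2] at h4
    exact h4.symm
  refine ⟨fun x δ _ hδ T hTs hT => ?_, fun x => ?_⟩
  · exact hT.subsingleton_of_fiber hf hS fun s hs t ht =>
      (hfib hδ (hTs hs)).trans (hfib hδ (hTs ht)).symm
  let _ : TopologicalSpace (stableClass dS φ x) := stableTopology dS φ (ε / 8) (bracket ε π) x
  have hbasic : ∀ y : stableClass dS φ x, ∀ δ, 0 < δ → δ < ε / 8 →
      IsOpen (Subtype.val ⁻¹' localStableSet dS (bracket ε π) y.1 δ : Set (stableClass dS φ x)) :=
    fun y δ h1 h2 => TopologicalSpace.isOpen_generateFrom_of_mem ⟨y.1, y.2, δ, h1, h2, rfl⟩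
  have hmem : ∀ y : S, ∀ δ, 0 < δ → y ∈ localStableSet dS (bracket ε π) y δ := by
    intro y δ hδ
    refine ⟨by rwa [hdS.self], IsBracket.bracket_eq hf hS ⟨rfl, fun m => ?_⟩⟩
    rw [dist_self]
    positivity
  have hval : Continuous (Subtype.val : stableClass dS φ x → S) := by
    rw [continuous_def]
    intro U hU
    rw [isOpen_iff_mem_nhds]
    intro y hy
    obtain ⟨r, hr, hU⟩ := (hdS.isOpen_iff U).1 hU y.1 hy
    have hδ : 0 < min r (ε / 16) := lt_min hr (by positivity)
    refine mem_of_superset ((hbasic y _ hδ ((min_le_right _ _).trans_lt (by linarith))).mem_nhds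
      (hmem _ _ hδ)) fun z hz => ?_
    exact hU _ (hz.1.trans_le (min_le_left _ _))
  -- Basic neighbourhoods lie in fibres of `π 0`, so `π 0` is locally constant on the global stable
  -- set and its fibres there are clopen.
  have hopen : ∀ P : J → Prop, IsOpen {y : stableClass dS φ x | P (π 0 y.1)} := by
    intro P
    rw [isOpen_iff_mem_nhds]
    intro y hy
    refine mem_of_superset ((hbasic y (ε / 16) (by positivity) (by linarith)).mem_nhds
      (hmem _ _ (by positivity))) fun z hz => ?_
    have h1 : π 0 z.1 = π 0 y.1 := hfib (by linarith) hz
    show P (π 0 z.1)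
    rw [h1]
    exact hy
  refine ⟨fun T _ hT => ?_⟩
  have h1 : (Subtype.val '' T).Subsingleton := by
    refine (hT.image _ hval.continuousOn).subsingleton_of_fiber hf hS ?_
    rintro _ ⟨s, hs, rfl⟩ _ ⟨t, ht, rfl⟩
    have hclopen : IsClopen {y : stableClass dS φ x | π 0 y.1 = π 0 t.1} :=
      ⟨⟨hopen fun a => ¬ a = π 0 t.1⟩, hopen fun a => a = π 0 t.1⟩
    exact hT.subset_isClopen hclopen ⟨t, ht, rfl⟩ hs
  exact fun s hs t ht => Subtype.ext (h1 ⟨s, hs, rfl⟩ ⟨t, ht, rfl⟩)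

end InverseLimit

/-- If every element failed somewhere, finiteness would bound the first failures, and a witness at
that bound is impossible. -/
theorem Set.Finite.exists_forall_of_antitone {α : Type*} {N : Set α} (hN : N.Finite)
    {P : ℕ → α → Prop} (hanti : ∀ k a, P (k + 1) a → P k a) (h : ∀ k, ∃ a ∈ N, P k a) :
    ∃ a ∈ N, ∀ k, P k a := by
  by_contra! H
  choose! k hk using H
  obtain ⟨M, hM⟩ := (hN.image k).bddAbove
  obtain ⟨a, ha, hP⟩ := h M
  have hle : ∀ {i j : ℕ}, i ≤ j → P j a → P i a := by
    intro i j hij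
    induction j, hij using Nat.le_induction with
    | base => exact id
    | succ j _ ih => exact fun h => ih (hanti _ _ h)
  exact hk a ha (hle (hM ⟨a, ha, rfl⟩) hP)

/-! ### Bi-infinite paths: translation, extension and splicing -/

namespace DirectedGraph

variable {V : Type u} {Edge : Type v} {E : DirectedGraph V Edge}

theorem LeftPath.ext_edge {x y : E.LeftPath} (h : ∀ k, x.edge k = y.edge k) : x = y := by
  cases x; cases y
  congr
  exact funext h

theorem BiPath.ext_edge {x y : E.BiPath} (h : ∀ k, x.edge k = y.edge k) : x = y := by
  cases x; cases y
  congr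
  exact funext h

theorem BiPath.leftPart_final (x : E.BiPath) (m : ℤ) (n : ℕ) :
    (x.leftPart m).final n = x.segment (m - n + 1) n := by
  apply List.ext_getElem
  · simp [BiPath.segment]
  · intro i h1 h2
    simp only [LeftPath.length_final] at h1
    simp only [LeftPath.final, BiPath.segment, BiPath.leftPart, List.getElem_map,
      List.getElem_reverse, List.getElem_range, List.length_range]
    congr 1
    omega

theorem BiPath.segment_succ (x : E.BiPath) (n : ℤ) (k : ℕ) :
    x.segment n (k + 1) = x.segment n k ++ [x.edge (n + k)] := by
  simp [BiPath.segment, List.range_succ]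

theorem BiPath.shift_leftPart (x : E.BiPath) (m : ℤ) :
    (x.leftPart (m + 1)).shift = x.leftPart m :=
  LeftPath.ext_edge fun k => congrArg x.edge (by push_cast; omega)

theorem BiPath.leftPart_translate (x : E.BiPath) (m : ℤ) :
    x.translate.leftPart (m + 1) = x.leftPart m :=
  LeftPath.ext_edge fun k => congrArg x.edge (by omega)

/-- The inverse of the translation. -/
def BiPath.translateInv (x : E.BiPath) : E.BiPath :=
  ⟨fun n => x.edge (n + 1), fun n => x.chain (n + 1)⟩

theorem BiPath.translate_translateInv (x : E.BiPath) : x.translateInv.translate = x :=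
  BiPath.ext_edge fun k => congrArg x.edge (by omega)

theorem BiPath.translateInv_translate (x : E.BiPath) : x.translate.translateInv = x :=
  BiPath.ext_edge fun k => congrArg x.edge (by omega)

theorem BiPath.translate_segment (x : E.BiPath) (n : ℤ) (k : ℕ) :
    x.translate.segment n k = x.segment (n - 1) k :=
  List.map_congr_left fun i _ => congrArg x.edge (by omega)

theorem BiPath.translateInv_segment (x : E.BiPath) (n : ℤ) (k : ℕ) :
    x.translateInv.segment n k = x.segment (n + 1) k :=
  List.map_congr_left fun i _ => congrArg x.edge (by omega)

theorem BiPath.continuous_translate : Continuous (BiPath.translate (E := E)) := by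
  let _ : TopologicalSpace Edge := ⊥
  exact continuous_induced_rng.2
    (continuous_pi fun n => (continuous_apply (n - 1)).comp continuous_induced_dom)

theorem BiPath.continuous_translateInv : Continuous (BiPath.translateInv (E := E)) := by
  let _ : TopologicalSpace Edge := ⊥
  exact continuous_induced_rng.2
    (continuous_pi fun n => (continuous_apply (n + 1)).comp continuous_induced_dom)

theorem BiPath.translate_iterate_edge (x : E.BiPath) (N : ℕ) (n : ℤ) :
    (BiPath.translate^[N] x).edge n = x.edge (n - N) := by
  induction N generalizing n with
  | zero => simp
  | succ N ih =>
    rw [Function.iterate_succ_apply']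
    show (BiPath.translate^[N] x).edge (n - 1) = _
    rw [ih]
    congr 1
    push_cast
    omega

/-- Without sources, a path can be prolonged to the right forever by edges whose range is the
current source. -/
theorem NoSources.exists_leftPart_eq (hs : E.NoSources) (u : E.LeftPath) (m : ℤ) :
    ∃ x : E.BiPath, x.leftPart m = u := by
  choose e he using hs
  let a : ℕ → Edge := fun k => Nat.rec (u.edge 0) (fun _ f => e (E.s f)) k
  let z : ℤ → Edge := fun n => if n ≤ m then u.edge (m - n).toNat else a (n - m).toNat
  have hle : ∀ k : ℕ, z (m - k) = u.edge k := by
    intro k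
    simp only [z]
    rw [if_pos (by omega)]
    congr 1
    omega
  have hge : ∀ k : ℕ, z (m + k) = a k := by
    intro k
    simp only [z]
    split_ifs with h
    · obtain rfl : k = 0 := by omega
      simp [a]
    · congr 1
      omega
  refine ⟨⟨z, fun n => ?_⟩, LeftPath.ext_edge hle⟩
  rcases lt_or_ge n m with h | h
  · obtain ⟨k, rfl⟩ : ∃ k : ℕ, n = m - ((k + 1 : ℕ) : ℤ) := ⟨(m - n - 1).toNat, by omega⟩
    rw [show m - ((k + 1 : ℕ) : ℤ) + 1 = m - k by push_cast; omega, hle, hle]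
    exact u.chain k
  · obtain ⟨k, rfl⟩ : ∃ k : ℕ, n = m + k := ⟨(n - m).toNat, by omega⟩
    rw [show m + (k : ℤ) + 1 = m + ((k + 1 : ℕ) : ℤ) by push_cast; omega, hge, hge]
    exact (he _).symm

theorem exists_walk {μ : List Edge} {e f : Edge} (hμ : E.IsPath (E.s e) μ)
    (hf : E.source (E.s e) μ = E.r f) :
    ∃ w : ℕ → Edge, w 0 = e ∧ w (μ.length + 1) = f ∧
      ∀ i ≤ μ.length, E.s (w i) = E.r (w (i + 1)) := by
  induction μ generalizing e with
  | nil => exact ⟨fun i => if i = 0 then e else f, rfl, rfl, fun i hi => by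
      obtain rfl : i = 0 := by simpa using hi
      exact hf⟩
  | cons g μ ih =>
    obtain ⟨w, h0, h1, h2⟩ := ih hμ.2 hf
    refine ⟨fun i => Nat.casesOn i e w, rfl, h1, fun i hi => ?_⟩
    cases i with
    | zero =>
      show E.s e = E.r (w 0)
      rw [h0, hμ.1]
    | succ i => exact h2 i (by simpa using hi)

/-- Bi-infinite paths `x`, `y` can be joined by a path `μ` from the end of a block of `y` to the
beginning of a block of `x`. -/
theorem BiPath.exists_splice (x y : E.BiPath) (k : ℕ) {μ : List Edge}
    (hμ : E.IsPath (E.s (y.edge k)) μ) (hs : E.source (E.s (y.edge k)) μ = E.r (x.edge (-k)))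
    {N : ℕ} (hN : N = 2 * k + 1 + μ.length) :
    ∃ z : E.BiPath, ∀ i : ℤ, -k ≤ i → i ≤ k → z.edge i = x.edge i ∧ z.edge (i - N) = y.edge i := by
  obtain ⟨w, h0, h1, h2⟩ := exists_walk hμ hs
  -- From `-k` on `z` is `x`, up to `k - N` it is `y` moved left by `N`, and `w` fills the
  -- `μ.length` places between. The walk `w` also contains the two adjacent edges, so the chain
  -- condition at the seams is that of `w`.
  let z : ℤ → Edge := fun j => if -k ≤ j then x.edge j else
    if j ≤ k - N then y.edge (j + N) else w (j - (k - N)).toNat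
  have hx : ∀ j : ℤ, -k ≤ j → z j = x.edge j := fun j hj => if_pos hj
  have hy : ∀ j : ℤ, j ≤ k - N → z j = y.edge (j + N) := fun j hj => by
    simp only [z]
    rw [if_neg (by omega), if_pos hj]
  have hw : ∀ i : ℕ, i ≤ μ.length + 1 → z (k - N + i) = w i := by
    intro i hi
    rcases Nat.eq_zero_or_pos i with rfl | hi0
    · rw [hy _ (by omega), h0]
      congr 1
      omega
    rcases Nat.lt_or_ge μ.length i with hl | hl
    · obtain rfl : i = μ.length + 1 := by omega
      rw [hx _ (by push_cast; omega), h1]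
      congr 1
      push_cast
      omega
    · simp only [z]
      rw [if_neg (by omega), if_neg (by omega)]
      congr 1
      omega
  refine ⟨⟨z, fun j => ?_⟩, fun i h1 h2 => ⟨hx i h1, ?_⟩⟩
  · rcases le_or_gt (-(k : ℤ)) j with hj | hj
    · rw [hx _ hj, hx _ (by omega)]
      exact x.chain j
    rcases lt_or_ge j (k - N) with hj' | hj'
    · rw [hy _ hj'.le, hy _ (by omega), y.chain]
      congr 2
      omega
    · obtain ⟨i, rfl⟩ : ∃ i : ℕ, j = k - N + i := ⟨(j - (k - N)).toNat, by omega⟩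
      rw [hw i (by omega), show (k : ℤ) - N + i + 1 = k - N + ((i + 1 : ℕ) : ℤ) by push_cast; omega,
        hw (i + 1) (by omega)]
      exact h2 i (by omega)
  · show z (i - N) = _
    rw [hy _ (by omega)]
    congr 1
    omega

theorem NoSources.exists_path_of_le (hs : E.NoSources) {n : ℕ}
    (hn : ∀ v w : V, ∃ μ : List Edge, μ.length = n ∧ E.IsPath v μ ∧ E.source v μ = w) {l : ℕ}
    (hl : n ≤ l) (v w : V) : ∃ μ : List Edge, μ.length = l ∧ E.IsPath v μ ∧ E.source v μ = w := by
  obtain ⟨μ, hμ, hp⟩ := hs.exists_isPath v (l - n)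
  obtain ⟨ν, hν, hq, rfl⟩ := hn (E.source v μ) w
  exact ⟨μ ++ ν, by simp; omega, isPath_append hp hq, source_append _ _ _⟩

end DirectedGraph

/-! ### The solenoid as an inverse limit, and its dynamics -/

namespace SelfSimilarAction

variable {V : Type u} {Edge : Type v} {E : DirectedGraph V Edge} [Groupoid.{w} V]
  {A : SelfSimilarAction E}

theorem BiAsymp.leftPart {x y : E.BiPath} (h : A.BiAsymp x y) (m : ℤ) :
    A.LeftAsymp (x.leftPart m) (y.leftPart m) := by
  obtain ⟨g, hg, h⟩ := h
  refine ⟨fun n => g (m - (n + 1 : ℕ) + 1), hg.subset ?_, fun n => ?_⟩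
  · rintro _ ⟨n, rfl⟩
    exact ⟨_, rfl⟩
  · rw [BiPath.leftPart_final, BiPath.leftPart_final]
    exact h _ _

theorem MapsTo.segment_of_le {g : GroupoidElt V} {x y : E.BiPath} {n : ℤ} {k l : ℕ} (hkl : k ≤ l)
    (h : A.MapsTo g (x.segment n l) (y.segment n l)) :
    A.MapsTo g (x.segment n k) (y.segment n k) := by
  induction l, hkl using Nat.le_induction with
  | base => exact h
  | succ l _ ih =>
    rw [BiPath.segment_succ, BiPath.segment_succ] at h
    exact ih h.of_concat

/-- For fixed `n`, each block starting at `n` is matched by an element of `N` that may depend on the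
length of the block; as `N` is finite, one element serves all lengths. -/
theorem IsNucleus.biAsymp_of_leftPart {N : Set (GroupoidElt V)} (hN : A.IsNucleus N)
    {x y : E.BiPath} (h : ∀ m : ℕ, A.LeftAsymp (x.leftPart m) (y.leftPart m)) :
    A.BiAsymp x y := by
  have H : ∀ n : ℤ, ∃ g ∈ N, ∀ k, A.MapsTo g (x.segment n k) (y.segment n k) := by
    intro n
    refine hN.finite.exists_forall_of_antitone (fun k g h => h.segment_of_le k.le_succ)
      fun k => ?_
    -- The block is prolonged by `a` so that it ends at a non-negative position, where the
    -- hypothesis applies.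
    obtain ⟨a, ha⟩ : ∃ a : ℕ, 0 ≤ n + a := ⟨n.natAbs, by omega⟩
    obtain ⟨m, hm⟩ : ∃ m : ℕ, (m : ℤ) = n + k + a := ⟨(n + k + a).toNat, by omega⟩
    obtain ⟨g, hg, hh⟩ := hN.leftAsymp_iff.1 (h m) (k + a + 1)
    rw [BiPath.leftPart_final, BiPath.leftPart_final,
      show (m : ℤ) - ((k + a + 1 : ℕ) : ℤ) + 1 = n by push_cast; omega] at hh
    exact ⟨g, hg, hh.segment_of_le (by omega)⟩
  choose g hg h using H
  exact ⟨g, hN.finite.subset (by rintro _ ⟨n, rfl⟩; exact hg n), h⟩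

theorem BiAsymp.translate {x y : E.BiPath} (h : A.BiAsymp x y) :
    A.BiAsymp x.translate y.translate := by
  obtain ⟨g, hg, h⟩ := h
  refine ⟨fun n => g (n - 1), hg.subset (by rintro _ ⟨n, rfl⟩; exact ⟨_, rfl⟩), fun n k => ?_⟩
  rw [BiPath.translate_segment, BiPath.translate_segment]
  exact h _ _

theorem BiAsymp.translateInv {x y : E.BiPath} (h : A.BiAsymp x y) :
    A.BiAsymp x.translateInv y.translateInv := by
  obtain ⟨g, hg, h⟩ := h
  refine ⟨fun n => g (n + 1), hg.subset (by rintro _ ⟨n, rfl⟩; exact ⟨_, rfl⟩), fun n k => ?_⟩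
  rw [BiPath.translateInv_segment, BiPath.translateInv_segment]
  exact h _ _

variable [Finite V]

variable (A) in
/-- The homeomorphism `τ̃ : 𝒮 → 𝒮`, `[x] ↦ [τ(x)]`. -/
def translateSolenoid : A.Solenoid ≃ₜ A.Solenoid where
  toFun := Quotient.map' (s₁ := A.biSetoid) (s₂ := A.biSetoid) BiPath.translate
    fun _ _ h => BiAsymp.translate h
  invFun := Quotient.map' (s₁ := A.biSetoid) (s₂ := A.biSetoid) BiPath.translateInv
    fun _ _ h => BiAsymp.translateInv h
  left_inv := A.isQuotientMap_toSolenoid.surjective.forall.2 fun x =>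
    congrArg A.toSolenoid x.translateInv_translate
  right_inv := A.isQuotientMap_toSolenoid.surjective.forall.2 fun x =>
    congrArg A.toSolenoid x.translate_translateInv
  continuous_toFun := BiPath.continuous_translate.quotient_map' _
  continuous_invFun := BiPath.continuous_translateInv.quotient_map' _

theorem translateSolenoid_iterate (N : ℕ) (x : E.BiPath) :
    A.translateSolenoid^[N] (A.toSolenoid x) = A.toSolenoid (BiPath.translate^[N] x) := by
  induction N with
  | zero => rfl
  | succ N ih =>
    rw [Function.iterate_succ_apply', Function.iterate_succ_apply', ih]
    rfl

variable (A) in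
/-- The map `𝒮 → 𝒥`, `[x] ↦ [x(-∞, m)]`. -/
def solenoidProj (m : ℕ) : A.Solenoid → A.LimitSpace :=
  Quotient.map' (s₁ := A.biSetoid) (s₂ := A.leftSetoid) (fun x => x.leftPart m)
    fun _ _ h => BiAsymp.leftPart h m

theorem solenoidProj_toSolenoid (m : ℕ) (x : E.BiPath) :
    A.solenoidProj m (A.toSolenoid x) = A.toLimitSpace (x.leftPart m) := rfl

/-- A compatible sequence `z` is realised by compactness: the sets of points with `m`-th projection
`z m` are closed, decreasing, and non-empty because every left-infinite path extends to the right.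
-/
theorem IsNucleus.isInverseLimit_solenoid [Finite Edge] {N : Set (GroupoidElt V)}
    (hN : A.IsNucleus N) (hs : E.NoSources) [T1Space A.LimitSpace] :
    IsInverseLimit A.shiftLimit A.solenoidProj A.translateSolenoid := by
  have hsurj := A.isQuotientMap_toSolenoid.surjective
  have hcont : ∀ m, Continuous (A.solenoidProj m) := fun m =>
    (BiPath.continuous_leftPart m).quotient_map' _
  have hsucc : ∀ m s, A.shiftLimit (A.solenoidProj (m + 1) s) = A.solenoidProj m s := by
    refine fun m => hsurj.forall.2 fun x => ?_
    rw [solenoidProj_toSolenoid, shiftLimit_toLimitSpace, Nat.cast_succ, BiPath.shift_leftPart]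
    rfl
  refine ⟨hcont, hsucc, ?_, ?_, ?_, ?_⟩
  · refine hsurj.forall₂.2 fun x y h => A.toSolenoid_eq_iff.2 (hN.biAsymp_of_leftPart fun m => ?_)
    exact A.toLimitSpace_eq_iff.1 (h m)
  · intro z hz
    let C : ℕ → Set A.Solenoid := fun m => A.solenoidProj m ⁻¹' {z m}
    have hclosed : ∀ m, IsClosed (C m) := fun m => isClosed_singleton.preimage (hcont m)
    obtain ⟨s, hs⟩ := IsCompact.nonempty_iInter_of_sequence_nonempty_isCompact_isClosed C
      (fun m s (h : A.solenoidProj (m + 1) s = z (m + 1)) => by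
        show A.solenoidProj m s = z m
        rw [← hsucc, h, hz])
      (fun m => by
        obtain ⟨u, hu⟩ := A.isQuotientMap_toLimitSpace.surjective (z m)
        obtain ⟨x, rfl⟩ := hs.exists_leftPart_eq u m
        exact ⟨A.toSolenoid x, hu⟩)
      (hclosed 0).isCompact hclosed
    exact ⟨s, fun m => Set.mem_iInter.1 hs m⟩
  · refine hsurj.forall.2 fun x => ?_
    show A.toLimitSpace (x.translate.leftPart (0 : ℕ)) = A.toLimitSpace (x.leftPart (0 : ℕ)).shift
    congr 1
    exact LeftPath.ext_edge fun k => congrArg x.edge (by push_cast; omega)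
  · refine fun m => hsurj.forall.2 fun x => ?_
    show A.toLimitSpace (x.translate.leftPart (m + 1 : ℕ)) = A.toLimitSpace (x.leftPart m)
    rw [Nat.cast_succ, BiPath.leftPart_translate]

/-- The vertices come from representatives of a point of `U` and a point of `W` and depend only on
the two sets. Any path between them splices the two central blocks, so its length alone decides
which iterate is reached. -/
theorem nonempty_iterate_translateSolenoid {U W : Set A.Solenoid} (hU : IsOpen U) (hW : IsOpen W)
    (hUn : U.Nonempty) (hWn : W.Nonempty) :
    ∃ (k : ℕ) (v w : V), ∀ μ : List Edge, E.IsPath v μ → E.source v μ = w →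
      (A.translateSolenoid^[2 * k + 1 + μ.length] '' U ∩ W).Nonempty := by
  obtain ⟨s, hs⟩ := hUn
  obtain ⟨t, ht⟩ := hWn
  have hq := A.isQuotientMap_toSolenoid
  obtain ⟨x, rfl⟩ := hq.surjective s
  obtain ⟨y, rfl⟩ := hq.surjective t
  obtain ⟨k₁, hk₁⟩ := BiPath.exists_of_isOpen (hU.preimage hq.continuous) hs
  obtain ⟨k₂, hk₂⟩ := BiPath.exists_of_isOpen (hW.preimage hq.continuous) ht
  refine ⟨max k₁ k₂, E.s (y.edge (max k₁ k₂ : ℕ)), E.r (x.edge (-(max k₁ k₂ : ℕ))),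
    fun μ hμ hμ' => ?_⟩
  obtain ⟨z, hz⟩ := x.exists_splice y (max k₁ k₂) hμ hμ' rfl
  have h1 : A.toSolenoid z ∈ U := hk₁ z fun i hi hi' => (hz i (by omega) (by omega)).1
  refine ⟨_, ⟨_, h1, rfl⟩, ?_⟩
  rw [translateSolenoid_iterate]
  refine hk₂ _ fun i hi hi' => ?_
  rw [BiPath.translate_iterate_edge]
  exact (hz i (by omega) (by omega)).2

theorem isIrreducibleHomeo_translateSolenoid (h : E.StronglyConnected) :
    IsIrreducibleHomeo A.translateSolenoid := by
  intro U W hU hW hUn hWn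
  obtain ⟨k, v, w, H⟩ := nonempty_iterate_translateSolenoid hU hW hUn hWn
  obtain ⟨μ, hμ, hμ'⟩ := h.2 v w
  exact ⟨_, H μ hμ hμ'⟩

theorem isMixingHomeo_translateSolenoid (hs : E.NoSources) (h : E.Primitive) :
    IsMixingHomeo A.translateSolenoid := by
  intro U W hU hW hUn hWn
  obtain ⟨k, v, w, H⟩ := nonempty_iterate_translateSolenoid hU hW hUn hWn
  obtain ⟨n, -, hn⟩ := h
  refine ⟨2 * k + 1 + n, fun N hN => ?_⟩
  obtain ⟨l, rfl⟩ : ∃ l, N = 2 * k + 1 + l := ⟨N - (2 * k + 1), by omega⟩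
  obtain ⟨μ, rfl, hμ, hμ'⟩ := hs.exists_path_of_le hn (by omega : n ≤ l) v w
  exact H μ hμ hμ'

end SelfSimilarAction

theorem mainTheorem6 {V : Type u} {Edge : Type v} [Finite V] [Finite Edge] [Groupoid.{w} V]
    (E : DirectedGraph V Edge) (hsources : E.NoSources) (hsinks : E.NoSinks)
    (A : SelfSimilarAction E) (hcontracting : A.IsContracting) (hregular : A.IsRegular) :
    ∃ φ : A.Solenoid ≃ₜ A.Solenoid,
      (∀ x : E.BiPath, φ (A.toSolenoid x) = A.toSolenoid x.translate) ∧
      (∃ (dJ : A.LimitSpace → A.LimitSpace → ℝ) (ε c : ℝ), A.IsExpandingMetric dJ ε c) ∧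
      (∀ (dJ : A.LimitSpace → A.LimitSpace → ℝ) (ε c : ℝ), A.IsExpandingMetric dJ ε c →
        ∃ dS : A.Solenoid → A.Solenoid → ℝ,
          IsCompatibleMetric dS ∧
          (∀ x y : E.BiPath,
            IsLUB
              (Set.range fun m : ℕ => (1 / c) ^ m *
                dJ (A.toLimitSpace (x.leftPart m)) (A.toLimitSpace (y.leftPart m)))
              (dS (A.toSolenoid x) (A.toSolenoid y))) ∧
          ∃ (εS : ℝ) (br : A.Solenoid → A.Solenoid → A.Solenoid),
            IsSmaleSpace dS φ εS (1 / c) br ∧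
            HasTotallyDisconnectedStableSets dS φ εS br) ∧
      (E.StronglyConnected → IsIrreducibleHomeo φ) ∧
      (E.Primitive → IsMixingHomeo φ) := by
  refine ⟨A.translateSolenoid, fun _ => rfl,
    SelfSimilarAction.exists_isExpandingMetric hsources hcontracting hregular, ?_,
    SelfSimilarAction.isIrreducibleHomeo_translateSolenoid,
    SelfSimilarAction.isMixingHomeo_translateSolenoid hsources⟩
  intro dJ ε c h
  obtain ⟨N, hN⟩ := SelfSimilarAction.exists_nucleus hsources hcontracting
  let _ : MetricSpace A.LimitSpace := h.compatible.toMetricSpace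
  have hf : IsLocallyScaling A.shiftLimit ε c := ⟨h.ε_pos, h.one_lt, h.expand, h.image_ball⟩
  have hS := hN.isInverseLimit_solenoid hsources
  have hd := isLUB_supDist (π := A.solenoidProj) h.one_lt
  have hdS := isCompatibleMetric_supDist h.one_lt hS.continuous hS.ext
  exact ⟨_, hdS, fun x y => hd (A.toSolenoid x) (A.toSolenoid y), ε / 8, _,
    isSmaleSpace_of_isInverseLimit hf hS hdS hd,
    hasTotallyDisconnectedStableSets_of_isInverseLimit hf hS hdS hd⟩
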